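/- For $\alpha>0$, $\beta\in\mathbb R$ and a real number or a square real matrix $z$ let $E_{\alpha,\beta}(z)=\sum_{k\ge 0} z^k/\Gamma(\alpha k+\beta)$. Let $0<\alpha\le 1$, let $E=\{1,\dots,p+1\}$, let $\lambda_1,\dots,\lambda_p>0$, and let $Q=(q_{ij})_{i,j\in E}$ be a stochastic matrix such that $p+1$ is absorbing ($q_{p+1,p+1}=1$) and $q_{ii}=0$ for $i\le p$. Let $(Y_n)_{n\ge 0}$ be a Markov chain on $E$ with transition matrix $Q$ and, independently of it, let $Z^i_n$ ($1\le i\le p$, $n\ge 0$) be independent random variables, $Z^i_n$ having the Mittag-Leffler distribution $\mathrm{ML}(\alpha,\lambda_i)$ with density $\lambda_i x^{\alpha-1}E_{\alpha,\alpha}(-\lambda_i x^\alpha)$, $x>0$; put $Z^{p+1}_n=\infty$. Let $S_n=\sum_{k=0}^{n-1} Z^{Y_k}_k$, and let $X_t=Y_n$ for $S_n\le t<S_{n+1}$, $t\ge 0$, be the associated semi-Markov process. Let $P(t)=(p_{ij}(t))_{i,j=1}^p$ with $p_{ij}(t)=\mathbb P(X_t=j\mid X_0=i)$ (the conditioning is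 on an event of positive probability; for each $i$ an initial law that charges $i$ may be used), and let $T$ be the $p\times p$ matrix with entries $T_{ij}=\lambda_i q_{ij}$ for $i\ne j$ and $T_{ii}=-\lambda_i$. Let ${}^c_0D^\alpha_t$ denote the Caputo derivative, taken entrywise on matrices: $${}^c_0D^\alpha_t x(t)=\frac1{\Gamma(n-\alpha)}\int_0^t (t-\tau)^{n-\alpha-1}x^{(n)}(\tau)\,d\tau,\qquad n=\lceil\alpha\rceil,\ \alpha\ne n,$$ and ${}^c_0D^\alpha_t x=x^{(n)}$ if $\alpha=n$. Then $P(t)=E_{\alpha,1}(T t^\alpha)$ for all $t\ge 0$. Moreover, for every $t>0$ the Caputo derivative of $P$ at $t$ is well defined, in the sense that each entry of $P$ is continuous on $[0,t]$ and continuously differentiable on $(0,t]$ and, if $\alpha<1$, the integrand above is integrable on $(0,t)$; and the forward and backward Kolmogorov equations hold: $${}^c_0D^\alpha_t P(t)=T\,P(t)=P(t)\,T .$$ -/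

import Mathlib

open MeasureTheory ProbabilityTheory

noncomputable section

/-- The two-parameter Mittag-Leffler function `E_{α,β}(z) = ∑ₖ zᵏ / Γ(α k + β)`, for `z` in a real
topological algebra; it is used for real numbers and for square real matrices. -/
def mittagLeffler {A : Type*} [Ring A] [Algebra ℝ A] [TopologicalSpace A] (α β : ℝ) (z : A) : A :=
  ∑' k : ℕ, (Real.Gamma (α * k + β))⁻¹ • z ^ k

/-- The density `l x^(α-1) E_{α,α}(-l x^α)`, `x > 0`, of the Mittag-Leffler distribution
`ML(α, l)` (equal to `0` for `x ≤ 0`). -/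
def mittagLefflerPDF (α l x : ℝ) : ℝ :=
  if 0 < x then l * x ^ (α - 1) * mittagLeffler α α (-l * x ^ α) else 0

/-- The real random variable `Z` is `ML(α, l)`-distributed under `μ`: its distribution function is
the integral of the Mittag-Leffler density. -/
def HasMittagLefflerLaw {Ω : Type*} [MeasurableSpace Ω] (μ : Measure Ω) (Z : Ω → ℝ) (α l : ℝ) :
    Prop :=
  Measurable Z ∧
    ∀ x : ℝ, μ.real {ω | Z ω ≤ x} = ∫ u in Set.Iic x, mittagLefflerPDF α l u

/-- `Y` is a (time-homogeneous) Markov chain under `μ` with transition matrix `Q` (and arbitrary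
initial law). -/
def IsMarkovChain {Ω E : Type*} [MeasurableSpace Ω] [MeasurableSpace E] (μ : Measure Ω)
    (Q : Matrix E E ℝ) (Y : ℕ → Ω → E) : Prop :=
  (∀ n, Measurable (Y n)) ∧
    ∀ (n : ℕ) (y : ℕ → E),
      μ {ω | ∀ k ≤ n + 1, Y k ω = y k} =
        μ {ω | ∀ k ≤ n, Y k ω = y k} * ENNReal.ofReal (Q (y n) (y (n + 1)))

/-- The sojourn after the `n`-th jump. The states are `Fin (p + 1)`; the last state is absorbing,
so the sojourn there is infinite, and in a state `i < p` it is the variable `Z i n`. -/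
def sojourn {Ω : Type*} {p : ℕ} (Y : ℕ → Ω → Fin (p + 1)) (Z : Fin p → ℕ → Ω → ℝ) (n : ℕ) (ω : Ω) :
    ENNReal :=
  Fin.lastCases (motive := fun _ => ENNReal) ⊤ (fun i => ENNReal.ofReal (Z i n ω)) (Y n ω)

/-- The time of the `n`-th jump (`0` for `n = 0`, and infinite after absorption). -/
def jumpTime {Ω : Type*} {p : ℕ} (Y : ℕ → Ω → Fin (p + 1)) (Z : Fin p → ℕ → Ω → ℝ) (n : ℕ) (ω : Ω) :
    ENNReal :=
  ∑ k ∈ Finset.range n, sojourn Y Z k ω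

open Classical in
/-- The semi-Markov process: at time `t ≥ 0` it is in the state `Y n` for the (unique) `n` with
`jumpTime n ≤ t < jumpTime (n + 1)`; it is `none` if there is no such `n` (explosion). -/
def semiMarkovProcess {Ω : Type*} {p : ℕ} (Y : ℕ → Ω → Fin (p + 1)) (Z : Fin p → ℕ → Ω → ℝ)
    (t : ℝ) (ω : Ω) : Option (Fin (p + 1)) :=
  if h : ∃ n, jumpTime Y Z n ω ≤ ENNReal.ofReal t ∧ ENNReal.ofReal t < jumpTime Y Z (n + 1) ω
  then some (Y h.choose ω) else none

/-- The probabilistic input of the construction: `Y` is a Markov chain with transition matrix `Q`,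
the `Z i n` are independent, `Z i n` is `ML(α, lam i)`-distributed, and the family of all `Z i n`
is independent of the chain. -/
structure IsMLSemiMarkovData {Ω : Type*} [MeasurableSpace Ω] {p : ℕ} (μ : Measure Ω) (α : ℝ)
    (lam : Fin p → ℝ) (Q : Matrix (Fin (p + 1)) (Fin (p + 1)) ℝ)
    (Y : ℕ → Ω → Fin (p + 1)) (Z : Fin p → ℕ → Ω → ℝ) : Prop where
  isProbabilityMeasure : IsProbabilityMeasure μ
  markov : IsMarkovChain μ Q Y
  law : ∀ i n, HasMittagLefflerLaw μ (Z i n) α (lam i)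
  indep : iIndepFun (fun a : Fin p × ℕ => Z a.1 a.2) μ
  indep_chain : IndepFun (fun ω (n : ℕ) => Y n ω) (fun ω (a : Fin p × ℕ) => Z a.1 a.2 ω) μ

/-- The sub-intensity matrix `T`: the block of the intensity matrix that belongs to the states
`i < p`. -/
def subIntensity {p : ℕ} (lam : Fin p → ℝ) (Q : Matrix (Fin (p + 1)) (Fin (p + 1)) ℝ) :
    Matrix (Fin p) (Fin p) ℝ :=
  Matrix.of fun i j => if i = j then -lam i else lam i * Q i.castSucc j.castSucc

/-- The matrix `P(t)` of the probabilities `p_{ij}(t) = ℙ(X_t = j | X_0 = i)`, `i, j < p`.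
Row `i` is computed under a probability measure `μ i`. This covers both usual readings of the
conditional probability: one measure `μ i = μ` for all `i`, and a family in which the process
starts at `i` under `μ i`. -/
def transitionMatrix {Ω : Type*} [MeasurableSpace Ω] {p : ℕ} (μ : Fin p → Measure Ω)
    (X : ℝ → Ω → Option (Fin (p + 1))) (t : ℝ) : Matrix (Fin p) (Fin p) ℝ :=
  Matrix.of fun i j =>
    (ProbabilityTheory.cond (μ i) {ω | X 0 ω = some i.castSucc}).real
      {ω | X t ω = some j.castSucc}

/-- The Caputo derivative of order `α > 0` with base point `0`: with `n = ⌈α⌉` it is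
`Γ(n-α)⁻¹ ∫₀ᵗ (t-τ)^(n-α-1) x⁽ⁿ⁾(τ) dτ`, and for `α = n` it is the ordinary derivative `x⁽ⁿ⁾(t)`. -/
def caputoDeriv (α : ℝ) (x : ℝ → ℝ) (t : ℝ) : ℝ :=
  if α = ⌈α⌉₊ then iteratedDeriv ⌈α⌉₊ x t
  else (Real.Gamma (⌈α⌉₊ - α))⁻¹ *
    ∫ τ in (0 : ℝ)..t, (t - τ) ^ ((⌈α⌉₊ : ℝ) - α - 1) * iteratedDeriv ⌈α⌉₊ x τ

/-- Conditions under which the formula for the Caputo derivative of order `α > 0` at `t > 0` is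
meaningful: `x` is `n - 1` times continuously differentiable up to `0`, it is `n` times continuously
differentiable on `(0, t]`, and, unless `α` is an integer, the integrand is integrable. -/
structure CaputoDifferentiableAt (α : ℝ) (x : ℝ → ℝ) (t : ℝ) : Prop where
  contDiffOn : ContDiffOn ℝ ((⌈α⌉₊ - 1 : ℕ) : WithTop ℕ∞) x (Set.Icc 0 t)
  contDiffAt : ∀ s ∈ Set.Ioc 0 t, ContDiffAt ℝ (⌈α⌉₊ : WithTop ℕ∞) x s
  integrable : α ≠ ⌈α⌉₊ →
    IntervalIntegrable (fun τ => (t - τ) ^ ((⌈α⌉₊ : ℝ) - α - 1) * iteratedDeriv ⌈α⌉₊ x τ) volume 0 t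

/-- The entrywise Caputo derivative of a matrix-valued function. -/
def matrixCaputoDeriv {m n : Type*} (α : ℝ) (M : ℝ → Matrix m n ℝ) (t : ℝ) : Matrix m n ℝ :=
  Matrix.of fun i j => caputoDeriv α (fun s => M s i j) t

end

/-! The proof avoids Laplace transforms: the matrix Mittag-Leffler function is shown to solve the
Markov renewal equation, and iterating that equation over the jumps identifies it with the
transition probabilities.

Analytically, every function involved has the form `u^(β-1) * mlSeries α β v (u^α)`. By the Beta
integral, convolving two of these adds the indices `β` and takes the Cauchy product of the
coefficients (`integral_mlSeries_mul_mlSeries`). For coefficients `a^k` and `v (k+1) - a * v k` the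
Cauchy product telescopes, which gives `mlSeries_renewal`. With `v n = (T^n) k j` and `a = -lam k`,
the diagonal of `T` cancels and what remains is the renewal equation with kernel `q k l • ν k`
(`mlSeries_matrix_renewal`).

Probabilistically, decomposing over finite trajectories of the chain shows that the laws of the jump
times on the transient states satisfy a convolution recursion (`stateJumpLaw_succ`). Iterating the
renewal equation along this recursion splits off, at each step, the probability of being in `j` at
time `t` after exactly `n` jumps, and leaves a remainder. The remainder is dominated by `C * exp t`
times the total mass of `exp (-S_n)` on the transient states. That mass decays geometrically,
because each sojourn law is concentrated on the positive reals and there are finitely many states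
(`tendsto_sum_lintegral_exp_neg`). This one estimate takes care of both uniqueness and
non-explosion. Summation over `n` gives the formula for `P` (`hasSum_of_renewal`,
`cond_real_state_eq`).

The Caputo kernel is itself a one-term series of index `1 - α`, so the Caputo derivative just shifts
the coefficients, from `T^n` to `T^(n+1)` (`caputoDeriv_eq_of_eq_mlSeries`). Reading `T^(n+1)` as `T
* T^n` or as `T^n * T` gives the two Kolmogorov equations. -/

/-! ### Convergence, continuity and derivative of series of Mittag-Leffler type. -/

/-- Sequences of at most exponential growth. -/
def ExpBounded (v : ℕ → ℝ) : Prop :=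
  ∃ C R : ℝ, 0 ≤ C ∧ 0 ≤ R ∧ ∀ k, |v k| ≤ C * R ^ k

/-- The power series of Mittag-Leffler type with coefficients `v k / Γ(α k + β)`. -/
noncomputable def mlSeries (α β : ℝ) (v : ℕ → ℝ) (z : ℝ) : ℝ :=
  ∑' k : ℕ, (Real.Gamma (α * k + β))⁻¹ * (v k * z ^ k)

theorem ExpBounded.shift {v : ℕ → ℝ} (hv : ExpBounded v) : ExpBounded fun k => v (k + 1) := by
  obtain ⟨C, R, hC, hR, h⟩ := hv
  refine ⟨C * R, R, by positivity, hR, fun k => (h (k + 1)).trans_eq (by ring)⟩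

theorem ExpBounded.add {v w : ℕ → ℝ} (hv : ExpBounded v) (hw : ExpBounded w) :
    ExpBounded fun k => v k + w k := by
  obtain ⟨C, R, hC, hR, h⟩ := hv
  obtain ⟨D, S, hD, hS, h'⟩ := hw
  refine ⟨C + D, R + S, by positivity, by positivity, fun k => (abs_add_le _ _).trans ?_⟩
  rw [add_mul]
  refine add_le_add ((h k).trans ?_) ((h' k).trans ?_) <;> gcongr <;> linarith

theorem ExpBounded.const_mul {v : ℕ → ℝ} (hv : ExpBounded v) (c : ℝ) :
    ExpBounded fun k => c * v k := by
  obtain ⟨C, R, hC, hR, h⟩ := hv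
  refine ⟨|c| * C, R, by positivity, hR, fun k => ?_⟩
  rw [abs_mul, mul_assoc]
  exact mul_le_mul_of_nonneg_left (h k) (abs_nonneg c)

theorem expBounded_pow (a : ℝ) : ExpBounded fun k => a ^ k :=
  ⟨1, |a|, zero_le_one, abs_nonneg a, fun k => by simp [abs_pow]⟩

theorem expBounded_single_zero (c : ℝ) : ExpBounded fun k => if k = 0 then c else 0 := by
  refine ⟨|c|, 1, abs_nonneg c, zero_le_one, fun k => ?_⟩
  dsimp only
  split_ifs <;> simp

theorem ExpBounded.antidiagonal {v w : ℕ → ℝ} (hv : ExpBounded v) (hw : ExpBounded w) :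
    ExpBounded fun n => ∑ kl ∈ Finset.HasAntidiagonal.antidiagonal n, |v kl.1| * |w kl.2| := by
  obtain ⟨C, R, hC, hR, h⟩ := hv
  obtain ⟨D, S, hD, hS, h'⟩ := hw
  -- The factor 2 in the rate absorbs the number `n + 1 ≤ 2^n` of terms.
  refine ⟨C * D, 2 * (R + S), by positivity, by positivity, fun n => ?_⟩
  rw [abs_of_nonneg (by positivity)]
  calc ∑ kl ∈ Finset.HasAntidiagonal.antidiagonal n, |v kl.1| * |w kl.2|
      ≤ ∑ kl ∈ Finset.HasAntidiagonal.antidiagonal n, C * D * (R + S) ^ n := by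
        refine Finset.sum_le_sum fun kl hkl => ?_
        rw [Finset.HasAntidiagonal.mem_antidiagonal] at hkl
        rw [← hkl, pow_add]
        calc |v kl.1| * |w kl.2| ≤ (C * R ^ kl.1) * (D * S ^ kl.2) :=
              mul_le_mul (h _) (h' _) (abs_nonneg _) (by positivity)
          _ ≤ (C * (R + S) ^ kl.1) * (D * (R + S) ^ kl.2) := by gcongr <;> linarith
          _ = _ := by ring
    _ = (n + 1) * (C * D * (R + S) ^ n) := by simp
    _ ≤ 2 ^ n * (C * D * (R + S) ^ n) := by
        gcongr
        exact_mod_cast Nat.lt_two_pow_self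
    _ = _ := by rw [mul_pow]; ring

/-- Restrict the Gamma integral to `u > M`, where `u^(x-1) ≥ M^(x-1)`. As `M` is arbitrary, Gamma
outgrows every exponential, without Stirling's formula. -/
theorem Real.exp_neg_mul_rpow_le_Gamma {M x : ℝ} (hM : 0 < M) (hx : 1 ≤ x) :
    Real.exp (-M) * M ^ (x - 1) ≤ Real.Gamma x := by
  have hx0 : 0 < x := by linarith
  rw [Real.Gamma_eq_integral hx0]
  have hint := Real.GammaIntegral_convergent hx0
  calc Real.exp (-M) * M ^ (x - 1) = ∫ u in Set.Ioi M, Real.exp (-u) * M ^ (x - 1) := by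
        rw [integral_mul_const, integral_exp_neg_Ioi]
    _ ≤ ∫ u in Set.Ioi M, Real.exp (-u) * u ^ (x - 1) := by
        refine setIntegral_mono_on ?_ (hint.mono_set (Set.Ioi_subset_Ioi hM.le))
          measurableSet_Ioi fun u hu => ?_
        · exact (integrableOn_exp_neg_Ioi M).mul_const _
        · have : M < u := hu
          gcongr
    _ ≤ ∫ u in Set.Ioi 0, Real.exp (-u) * u ^ (x - 1) := by
        refine setIntegral_mono_set hint ?_ (Set.Ioi_subset_Ioi hM.le).eventuallyLE
        filter_upwards [self_mem_ae_restrict measurableSet_Ioi] with u hu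
        have : (0 : ℝ) < u := hu
        positivity

theorem summable_inv_Gamma_mul_pow {α : ℝ} (hα : 0 < α) {β : ℝ} (hβ : 0 < β) {R : ℝ} (hR : 0 ≤ R) :
    Summable fun k : ℕ => (Real.Gamma (α * k + β))⁻¹ * R ^ k := by
  -- Chosen so that `M^α = 2 (R + 1)`, which leaves a geometric series of ratio `1/2`; `R + 1` in
  -- place of `R` keeps `M` positive when `R = 0`.
  set M : ℝ := (2 * (R + 1)) ^ α⁻¹ with hM
  have hMpos : 0 < M := by positivity
  have hMα : M ^ α = 2 * (R + 1) := by
    rw [hM, ← Real.rpow_mul (by positivity), inv_mul_cancel₀ hα.ne', Real.rpow_one]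
  have hsum : Summable fun k : ℕ => (Real.exp M * M ^ (1 - β)) * (1 / 2 : ℝ) ^ k :=
    (summable_geometric_of_lt_one (by norm_num) (by norm_num)).mul_left _
  refine Summable.of_norm_bounded_eventually_nat hsum ?_
  obtain ⟨N, hN⟩ := exists_nat_gt (1 / α)
  filter_upwards [Filter.eventually_ge_atTop N] with k hk
  have hk1 : 1 ≤ α * k + β := by
    have h1 : 1 / α < k := hN.trans_le (by exact_mod_cast hk)
    rw [div_lt_iff₀ hα] at h1
    linarith
  have hG := Real.exp_neg_mul_rpow_le_Gamma hMpos hk1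
  have hpos : 0 < Real.exp (-M) * M ^ (α * k + β - 1) := by positivity
  rw [Real.norm_of_nonneg (mul_nonneg (inv_nonneg.2 (hpos.le.trans hG)) (by positivity))]
  calc (Real.Gamma (α * k + β))⁻¹ * R ^ k
      ≤ (Real.exp (-M) * M ^ (α * k + β - 1))⁻¹ * (R + 1) ^ k := by
        gcongr; linarith
    _ = _ := by
        have e : M ^ (α * k + β - 1) = (M ^ α) ^ k * (M ^ (1 - β))⁻¹ := by
          rw [← Real.rpow_natCast (M ^ α), ← Real.rpow_mul hMpos.le, ← Real.rpow_neg hMpos.le,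
            ← Real.rpow_add hMpos]
          congr 1; ring
        have hR1 : (R + 1) ≠ 0 := by linarith
        rw [e, hMα, Real.exp_neg, mul_pow]
        field_simp
        rw [← mul_pow]; norm_num

section
variable {α : ℝ} (hα : 0 < α) {β : ℝ} (hβ : 0 < β) {v : ℕ → ℝ} (hv : ExpBounded v)
include hα hβ hv

theorem ExpBounded.summable_abs (z : ℝ) :
    Summable fun k : ℕ => (Real.Gamma (α * k + β))⁻¹ * (|v k| * |z| ^ k) := by
  obtain ⟨C, R, hC, hR, h⟩ := hv
  have hs := (summable_inv_Gamma_mul_pow hα hβ (R := R * |z|) (by positivity)).mul_left C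
  refine Summable.of_nonneg_of_le (fun k => ?_) (fun k => ?_) hs
  · have := Real.Gamma_pos_of_pos (show 0 < α * k + β by positivity)
    positivity
  · have := Real.Gamma_pos_of_pos (show 0 < α * k + β by positivity)
    calc (Real.Gamma (α * k + β))⁻¹ * (|v k| * |z| ^ k)
        ≤ (Real.Gamma (α * k + β))⁻¹ * ((C * R ^ k) * |z| ^ k) := by gcongr; exact h k
      _ = _ := by rw [mul_pow]; ring

theorem ExpBounded.summable_norm (z : ℝ) :
    Summable fun k : ℕ => ‖(Real.Gamma (α * k + β))⁻¹ * (v k * z ^ k)‖ := by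
  refine (hv.summable_abs hα hβ z).congr fun k => ?_
  have := Real.Gamma_pos_of_pos (show 0 < α * k + β by positivity)
  simp [abs_of_pos this]

theorem continuous_mlSeries : Continuous (mlSeries α β v) := by
  rw [continuous_iff_continuousAt]
  intro z
  have hon : ContinuousOn (mlSeries α β v) (Metric.ball 0 (|z| + 1)) := by
    refine continuousOn_tsum (fun k => by fun_prop) (hv.summable_abs hα hβ (|z| + 1)) ?_
    intro k x hx
    have := Real.Gamma_pos_of_pos (show 0 < α * k + β by positivity)
    have hx' : |x| ≤ |(|z| + 1)| := by
      rw [abs_of_nonneg (by positivity : 0 ≤ |z| + 1)]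
      simpa using (mem_ball_zero_iff.1 hx).le
    simp only [norm_mul, norm_inv, Real.norm_eq_abs, norm_pow, abs_of_pos this]
    gcongr
  exact hon.continuousAt (Metric.isOpen_ball.mem_nhds (by simp))

end

/-- Termwise differentiation: the constant term drops out, and after reindexing the functional
equation of Gamma turns `(k+1) / Γ(α(k+1) + 1)` into `α⁻¹ / Γ(αk + α)`. -/
theorem hasDerivAt_mlSeries {α : ℝ} (hα : 0 < α) {v : ℕ → ℝ} (hv : ExpBounded v) (z : ℝ) :
    HasDerivAt (mlSeries α 1 v) (α⁻¹ * mlSeries α α (fun k => v (k + 1)) z) z := by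
  set B : ℝ := |z| + 1 with hB
  have hB1 : 1 ≤ B := by simp [hB]
  -- The factor `k` produced by differentiation is at most `2^k`, so the series at `2 * B` dominates
  -- the differentiated series on the ball of radius `B`.
  have hs := hv.summable_abs hα one_pos (2 * B)
  have key := hasDerivAt_tsum_of_isPreconnected (𝕜 := ℝ)
    (g := fun (k : ℕ) (y : ℝ) => (Real.Gamma (α * k + 1))⁻¹ * (v k * y ^ k))
    (g' := fun (k : ℕ) (y : ℝ) => (Real.Gamma (α * k + 1))⁻¹ * (v k * (k * y ^ (k - 1))))
    (t := Metric.ball 0 B) (y₀ := 0) (y := z) hs Metric.isOpen_ball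
    (convex_ball 0 B).isPreconnected
    (fun k y _ => ((hasDerivAt_pow k y).const_mul _).const_mul _) ?_ (by simp; linarith)
    (hv.summable_norm hα one_pos 0).of_norm (by simp [hB])
  · refine key.congr_deriv ?_
    rw [mlSeries, ← tsum_mul_left]
    have hs' : Summable fun k : ℕ =>
        α⁻¹ * ((Real.Gamma (α * k + α))⁻¹ * (v (k + 1) * z ^ k)) :=
      ((hv.shift.summable_norm hα hα z).of_norm).mul_left _
    have hterm : ∀ k : ℕ, (Real.Gamma (α * (k + 1 : ℕ) + 1))⁻¹ *
        (v (k + 1) * ((k + 1 : ℕ) * z ^ (k + 1 - 1))) =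
        α⁻¹ * ((Real.Gamma (α * k + α))⁻¹ * (v (k + 1) * z ^ k)) := by
      intro k
      have hp : 0 < α * k + α := by positivity
      have e : α * ((k + 1 : ℕ) : ℝ) = α * k + α := by push_cast; ring
      have hG := (Real.Gamma_pos_of_pos hp).ne'
      have hk : (k : ℝ) + 1 ≠ 0 := by positivity
      rw [e, Real.Gamma_add_one hp.ne', Nat.add_sub_cancel,
        show α * k + α = α * (k + 1) by ring] at *
      push_cast
      field_simp
    rw [Summable.tsum_eq_zero_add ((summable_nat_add_iff 1).1 (hs'.congr fun k => (hterm k).symm))]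
    simp only [hterm]
    simp
  · intro k y hy
    have := Real.Gamma_pos_of_pos (show 0 < α * k + 1 by positivity)
    have hy' : |y| ≤ B := by simpa using (mem_ball_zero_iff.1 hy).le
    simp only [norm_mul, norm_inv, Real.norm_eq_abs, norm_pow, abs_of_pos this, Nat.abs_cast]
    rw [abs_of_nonneg (by linarith : (0 : ℝ) ≤ 2 * B), mul_pow]
    gcongr
    · exact_mod_cast Nat.lt_two_pow_self.le
    · calc |y| ^ (k - 1) ≤ B ^ (k - 1) := by gcongr
        _ ≤ B ^ k := pow_le_pow_right₀ hB1 (Nat.sub_le _ _)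

/-! ### The Beta integral and fractional convolution. -/

/-- Cut at `t / 2`: each half contains only one of the two possible singularities, and `u ↦ t - u`
exchanges the halves. -/
theorem intervalIntegrable_rpow_mul_sub_rpow {a b t : ℝ} (ha : 0 < a) (hb : 0 < b) (ht : 0 < t) :
    IntervalIntegrable (fun u => u ^ (a - 1) * (t - u) ^ (b - 1)) volume 0 t := by
  have left : ∀ {a b : ℝ}, 0 < a →
      IntervalIntegrable (fun u => u ^ (a - 1) * (t - u) ^ (b - 1)) volume 0 (t / 2) := by
    intro a b ha
    refine (intervalIntegral.intervalIntegrable_rpow' (by linarith)).mul_continuousOn ?_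
    rw [Set.uIcc_of_le (by positivity)]
    intro u hu
    refine ContinuousAt.continuousWithinAt ?_
    exact ContinuousAt.rpow_const (by fun_prop) (Or.inl (by have := hu.2; linarith))
  refine (left ha).trans ?_
  have h := ((left (b := a) hb).comp_sub_left t).symm
  simp only [sub_zero, sub_sub_cancel, sub_half] at h
  exact h.congr fun u _ => mul_comm _ _

theorem integral_rpow_mul_sub_rpow {a b t : ℝ} (ha : 0 < a) (hb : 0 < b) (ht : 0 < t) :
    ∫ u in (0 : ℝ)..t, u ^ (a - 1) * (t - u) ^ (b - 1) =
      t ^ (a + b - 1) * (Real.Gamma a * Real.Gamma b / Real.Gamma (a + b)) := by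
  have h := Complex.betaIntegral_scaled a b ht
  rw [Complex.betaIntegral_eq_Gamma_mul_div _ _ (by simpa) (by simpa)] at h
  have e : ∫ x in (0 : ℝ)..t, (x : ℂ) ^ ((a : ℂ) - 1) * ((t : ℂ) - x) ^ ((b : ℂ) - 1) =
      ((∫ u in (0 : ℝ)..t, u ^ (a - 1) * (t - u) ^ (b - 1) : ℝ) : ℂ) := by
    rw [← intervalIntegral.integral_ofReal]
    refine intervalIntegral.integral_congr fun x hx => ?_
    rw [Set.uIcc_of_le ht.le] at hx
    simp only [Complex.ofReal_mul]
    rw [Complex.ofReal_cpow hx.1, Complex.ofReal_cpow (by linarith [hx.2])]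
    push_cast
    rfl
  rw [e, ← Complex.ofReal_add, Complex.Gamma_ofReal, Complex.Gamma_ofReal, Complex.Gamma_ofReal,
    show ((a + b : ℝ) : ℂ) - 1 = ((a + b - 1 : ℝ) : ℂ) by push_cast; rfl,
    ← Complex.ofReal_cpow ht.le] at h
  exact_mod_cast h

section
variable {α : ℝ} (hα : 0 < α) {β γ : ℝ} (hβ : 0 < β) (hγ : 0 < γ) {v w : ℕ → ℝ}
  (hv : ExpBounded v) (hw : ExpBounded w) {t : ℝ} (ht : 0 < t)
include hα hβ hγ hv hw ht

theorem intervalIntegrable_mlSeries_mul_mlSeries :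
    IntervalIntegrable (fun u => (u ^ (β - 1) * mlSeries α β v (u ^ α)) *
      ((t - u) ^ (γ - 1) * mlSeries α γ w ((t - u) ^ α))) volume 0 t := by
  have h1 : Continuous fun u : ℝ => mlSeries α β v (u ^ α) :=
    (continuous_mlSeries hα hβ hv).comp (Real.continuous_rpow_const hα.le)
  have h2 : Continuous fun u : ℝ => mlSeries α γ w ((t - u) ^ α) :=
    (continuous_mlSeries hα hγ hw).comp ((Real.continuous_rpow_const hα.le).comp (by fun_prop))
  exact ((intervalIntegrable_rpow_mul_sub_rpow hβ hγ ht).mul_continuousOn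
    (h1.mul h2).continuousOn).congr fun u _ => mul_mul_mul_comm _ _ _ _

/-- The fractional convolution of two series of Mittag-Leffler type. -/
theorem integral_mlSeries_mul_mlSeries :
    ∫ u in (0 : ℝ)..t, (u ^ (β - 1) * mlSeries α β v (u ^ α)) *
      ((t - u) ^ (γ - 1) * mlSeries α γ w ((t - u) ^ α)) =
    t ^ (β + γ - 1) * mlSeries α (β + γ)
      (fun n => ∑ kl ∈ Finset.HasAntidiagonal.antidiagonal n, v kl.1 * w kl.2) (t ^ α) := by
  set f : ℕ → ℕ → ℝ → ℝ := fun k l u =>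
    ((Real.Gamma (α * k + β))⁻¹ * (Real.Gamma (α * l + γ))⁻¹) *
      (u ^ (α * k + β - 1) * (t - u) ^ (α * l + γ - 1)) with hf
  have Gβ : ∀ k : ℕ, 0 < Real.Gamma (α * k + β) := fun k =>
    Real.Gamma_pos_of_pos (by positivity)
  have Gγ : ∀ k : ℕ, 0 < Real.Gamma (α * k + γ) := fun k =>
    Real.Gamma_pos_of_pos (by positivity)
  have hfint : ∀ k l, IntegrableOn (f k l) (Set.Ioo 0 t) := fun k l =>
    ((intervalIntegrable_iff_integrableOn_Ioo_of_le ht.le).1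
      (intervalIntegrable_rpow_mul_sub_rpow (a := α * k + β) (b := α * l + γ)
        (by positivity) (by positivity) ht)).const_mul _
  -- The normalized Beta value depends on `k + l` only; this is why the Cauchy product of the
  -- coefficients appears.
  have hfval : ∀ k l n : ℕ, k + l = n → ∫ u in Set.Ioo 0 t, f k l u =
      t ^ (β + γ - 1) * ((Real.Gamma (α * n + (β + γ)))⁻¹ * (t ^ α) ^ n) := by
    intro k l n hkl
    rw [integral_const_mul, ← integral_Ioc_eq_integral_Ioo,
      ← intervalIntegral.integral_of_le ht.le,
      integral_rpow_mul_sub_rpow (by positivity) (by positivity) ht]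
    have e : α * k + β + (α * l + γ) = α * n + (β + γ) := by rw [← hkl]; push_cast; ring
    have e2 : t ^ (α * n + (β + γ) - 1) = t ^ (β + γ - 1) * (t ^ α) ^ n := by
      rw [← Real.rpow_natCast, ← Real.rpow_mul ht.le, ← Real.rpow_add ht]
      congr 1; ring
    rw [e, e2]
    have := (Gβ k).ne'
    have := (Gγ l).ne'
    field_simp
  have hfnn : ∀ k l, ∀ u ∈ Set.Ioo 0 t, 0 ≤ f k l u := fun k l u hu => by
    have := (Gβ k)
    have := (Gγ l)
    have := hu.1
    have : 0 < t - u := sub_pos.2 hu.2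
    positivity
  set F : ℕ → ℝ → ℝ := fun n u =>
    ∑ kl ∈ Finset.HasAntidiagonal.antidiagonal n, (v kl.1 * w kl.2) * f kl.1 kl.2 u with hF
  have hFint : ∀ n, IntegrableOn (F n) (Set.Ioo 0 t) := fun n =>
    integrable_finsetSum _ fun kl _ => (hfint _ _).const_mul _
  have hFval : ∀ n, ∫ u in Set.Ioo 0 t, F n u = t ^ (β + γ - 1) *
      ((Real.Gamma (α * n + (β + γ)))⁻¹ *
        ((∑ kl ∈ Finset.HasAntidiagonal.antidiagonal n, v kl.1 * w kl.2) * (t ^ α) ^ n)) := by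
    intro n
    rw [integral_finsetSum _ fun kl _ => (hfint _ _).const_mul _, Finset.sum_mul,
      Finset.mul_sum, Finset.mul_sum]
    refine Finset.sum_congr rfl fun kl hkl => ?_
    rw [integral_const_mul, hfval _ _ n (Finset.HasAntidiagonal.mem_antidiagonal.1 hkl)]
    ring
  -- As `f k l` is nonnegative, the norms are controlled by the same integrals with `|v|` and `|w|`;
  -- this justifies exchanging sum and integral.
  have hFnorm : ∀ n, ∫ u in Set.Ioo 0 t, ‖F n u‖ ≤ t ^ (β + γ - 1) *
      ((Real.Gamma (α * n + (β + γ)))⁻¹ *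
        (|(∑ kl ∈ Finset.HasAntidiagonal.antidiagonal n, |v kl.1| * |w kl.2|)| *
          |t ^ α| ^ n)) := by
    intro n
    have : ∫ u in Set.Ioo 0 t, ‖F n u‖ ≤ ∫ u in Set.Ioo 0 t,
        ∑ kl ∈ Finset.HasAntidiagonal.antidiagonal n, (|v kl.1| * |w kl.2|) * f kl.1 kl.2 u := by
      refine setIntegral_mono_on (hFint n).norm
        (integrable_finsetSum _ fun kl _ => (hfint _ _).const_mul _) measurableSet_Ioo ?_
      intro u hu
      refine (norm_sum_le _ _).trans (Finset.sum_le_sum fun kl _ => ?_)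
      rw [norm_mul, norm_mul, Real.norm_of_nonneg (hfnn _ _ u hu), Real.norm_eq_abs,
        Real.norm_eq_abs]
    refine this.trans_eq ?_
    rw [integral_finsetSum _ fun kl _ => (hfint _ _).const_mul _,
      abs_of_nonneg (by positivity), abs_of_nonneg (by positivity), Finset.sum_mul,
      Finset.mul_sum, Finset.mul_sum]
    refine Finset.sum_congr rfl fun kl hkl => ?_
    rw [integral_const_mul, hfval _ _ n (Finset.HasAntidiagonal.mem_antidiagonal.1 hkl)]
    ring
  have hsum : Summable fun n => ∫ u in Set.Ioo 0 t, ‖F n u‖ :=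
    Summable.of_nonneg_of_le (fun n => integral_nonneg fun u => norm_nonneg _) hFnorm
      (((hv.antidiagonal hw).summable_abs hα (add_pos hβ hγ) (t ^ α)).mul_left _)
  have hmain := (hasSum_integral_of_summable_integral_norm hFint hsum).tsum_eq
  simp only [hFval] at hmain
  rw [tsum_mul_left] at hmain
  rw [mlSeries, hmain, intervalIntegral.integral_of_le ht.le, integral_Ioc_eq_integral_Ioo]
  refine setIntegral_congr_fun measurableSet_Ioo fun u hu => ?_
  have hu1 : 0 < u := hu.1
  have hu2 : 0 < t - u := sub_pos.2 hu.2
  rw [mul_mul_mul_comm, mlSeries, mlSeries,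
    tsum_mul_tsum_eq_tsum_sum_antidiagonal_of_summable_norm (hv.summable_norm hα hβ _)
      (hw.summable_norm hα hγ _), ← tsum_mul_left]
  refine tsum_congr fun n => ?_
  rw [Finset.mul_sum]
  refine Finset.sum_congr rfl fun kl _ => ?_
  have e1 : u ^ (α * kl.1 + β - 1) = u ^ (β - 1) * (u ^ α) ^ kl.1 := by
    rw [← Real.rpow_natCast, ← Real.rpow_mul hu1.le, ← Real.rpow_add hu1]
    congr 1; ring
  have e2 : (t - u) ^ (α * kl.2 + γ - 1) = (t - u) ^ (γ - 1) * ((t - u) ^ α) ^ kl.2 := by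
    rw [← Real.rpow_natCast, ← Real.rpow_mul hu2.le, ← Real.rpow_add hu2]
    congr 1; ring
  simp only [hf, e1, e2]
  ring

end

/-! ### The scalar renewal equation and smoothness in time. -/

/-- In generating functions, with `V(x) = ∑ v n * x^n`: dividing `(V(x) - v 0)/x - a V(x)` by `1 - a
x` gives `(V(x) - v 0 / (1 - a x)) / x`. -/
theorem sum_antidiagonal_pow_mul_shift_sub (a : ℝ) (v : ℕ → ℝ) (n : ℕ) :
    ∑ kl ∈ Finset.HasAntidiagonal.antidiagonal n, a ^ kl.1 * (v (kl.2 + 1) - a * v kl.2) =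
      v (n + 1) - a ^ (n + 1) * v 0 := by
  induction n with
  | zero => simp
  | succ n ih =>
    rw [Finset.Nat.sum_antidiagonal_succ]
    simp only [pow_succ', mul_assoc]
    rw [← Finset.mul_sum, ih]
    ring

section
variable {α : ℝ} (hα : 0 < α) {v : ℕ → ℝ} (hv : ExpBounded v)

theorem mlSeries_zero {β : ℝ} : mlSeries α β v 0 = (Real.Gamma β)⁻¹ * v 0 := by
  rw [mlSeries, tsum_eq_single 0 fun k hk => by simp [hk]]
  simp

theorem mlSeries_single_zero {β : ℝ} (c z : ℝ) :
    mlSeries α β (fun k => if k = 0 then c else 0) z = (Real.Gamma β)⁻¹ * c := by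
  rw [mlSeries, tsum_eq_single 0 fun k hk => by simp [hk]]
  simp

include hα hv

theorem mlSeries_one_eq_add (z : ℝ) :
    mlSeries α 1 v z = v 0 + z * mlSeries α (α + 1) (fun k => v (k + 1)) z := by
  rw [mlSeries, (hv.summable_norm hα one_pos z).of_norm.tsum_eq_zero_add, mlSeries, ← tsum_mul_left]
  congr 1
  · simp
  · refine tsum_congr fun k => ?_
    rw [show α * ((k + 1 : ℕ) : ℝ) + 1 = α * k + (α + 1) by push_cast; ring]
    ring

/-- The renewal equation for series of Mittag-Leffler type. -/
theorem mlSeries_renewal (a : ℝ) {t : ℝ} (ht : 0 < t) :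
    mlSeries α 1 v (t ^ α) = v 0 * mlSeries α 1 (fun k => a ^ k) (t ^ α) +
      ∫ u in (0 : ℝ)..t, (u ^ (α - 1) * mlSeries α α (fun k => a ^ k) (u ^ α)) *
        mlSeries α 1 (fun k => v (k + 1) - a * v k) ((t - u) ^ α) := by
  have hw : ExpBounded fun k => v (k + 1) - a * v k := by
    simpa [sub_eq_add_neg] using hv.shift.add (hv.const_mul (-a))
  -- The convolution has index `α + 1`, which is also the index of a series of index 1 after its
  -- constant term is removed.
  have h := integral_mlSeries_mul_mlSeries hα hα one_pos (expBounded_pow a) hw ht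
  simp only [sub_self, Real.rpow_zero, one_mul, add_sub_cancel_right,
    sum_antidiagonal_pow_mul_shift_sub] at h
  have hs : ExpBounded fun k => a ^ (k + 1) * v 0 := by
    simpa [mul_comm] using (expBounded_pow a).shift.const_mul (v 0)
  rw [h, mlSeries_one_eq_add hα hv, mlSeries_one_eq_add hα (expBounded_pow a)]
  have e : mlSeries α (α + 1) (fun n => v (n + 1) - a ^ (n + 1) * v 0) (t ^ α) =
      mlSeries α (α + 1) (fun n => v (n + 1)) (t ^ α) -
        v 0 * mlSeries α (α + 1) (fun n => a ^ (n + 1)) (t ^ α) := by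
    have hα1 : 0 < α + 1 := by positivity
    rw [mlSeries, mlSeries, mlSeries, ← tsum_mul_left, ← Summable.tsum_sub
      (hv.shift.summable_norm hα hα1 _).of_norm
      (((expBounded_pow a).shift.summable_norm hα hα1 _).of_norm.mul_left _)]
    refine tsum_congr fun k => by ring
  rw [e]
  ring

theorem hasDerivAt_mlSeries_rpow {t : ℝ} (ht : 0 < t) :
    HasDerivAt (fun s => mlSeries α 1 v (s ^ α))
      (t ^ (α - 1) * mlSeries α α (fun k => v (k + 1)) (t ^ α)) t := by
  refine ((hasDerivAt_mlSeries hα hv (t ^ α)).comp t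
    (Real.hasDerivAt_rpow_const (p := α) (Or.inl ht.ne'))).congr_deriv ?_
  field_simp

theorem contDiffAt_mlSeries_rpow {t : ℝ} (ht : 0 < t) :
    ContDiffAt ℝ 1 (fun s => mlSeries α 1 v (s ^ α)) t := by
  have h : ContDiff ℝ 1 (mlSeries α 1 v) := by
    rw [contDiff_one_iff_deriv]
    refine ⟨fun z => (hasDerivAt_mlSeries hα hv z).differentiableAt, ?_⟩
    rw [show deriv (mlSeries α 1 v) = _ from funext fun z => (hasDerivAt_mlSeries hα hv z).deriv]
    exact continuous_const.mul (continuous_mlSeries hα hα hv.shift)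
  exact h.contDiffAt.comp t (Real.contDiffAt_rpow_const_of_ne ht.ne')

end

/-! ### Caputo derivatives of Mittag-Leffler series. -/

theorem natCeil_eq_one_of_pos_of_le_one {α : ℝ} (hα : 0 < α) (hα1 : α ≤ 1) : ⌈α⌉₊ = 1 := by
  rw [Nat.ceil_eq_iff one_ne_zero]
  simpa using ⟨hα, hα1⟩

section
variable {α : ℝ} (hα : 0 < α) (hα1 : α ≤ 1) {v : ℕ → ℝ} (hv : ExpBounded v) {x : ℝ → ℝ}
  (hx : ∀ s, 0 ≤ s → x s = mlSeries α 1 v (s ^ α)) {t : ℝ} (ht : 0 < t)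
include hα hα1 hv hx ht

omit hα1 in
theorem iteratedDeriv_one_eq_of_eq_mlSeries :
    iteratedDeriv 1 x t = t ^ (α - 1) * mlSeries α α (fun k => v (k + 1)) (t ^ α) := by
  rw [iteratedDeriv_one]
  refine ((hasDerivAt_mlSeries_rpow hα hv ht).congr_of_eventuallyEq ?_).deriv
  filter_upwards [lt_mem_nhds ht] with s hs using hx s hs.le

theorem caputoDifferentiableAt_of_eq_mlSeries : CaputoDifferentiableAt α x t := by
  have hc := natCeil_eq_one_of_pos_of_le_one hα hα1
  constructor
  · rw [hc]
    have h : Continuous fun u : ℝ => mlSeries α 1 v (u ^ α) :=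
      (continuous_mlSeries hα one_pos hv).comp (Real.continuous_rpow_const hα.le)
    simpa using h.continuousOn.congr fun s hs => hx s hs.1
  · intro s hs
    rw [hc]
    refine (contDiffAt_mlSeries_rpow hα hv hs.1).congr_of_eventuallyEq ?_
    filter_upwards [lt_mem_nhds hs.1] with s hs using hx s hs.le
  · intro hne
    rw [hc, Nat.cast_one] at *
    have hlt : 0 < 1 - α := sub_pos.2 (lt_of_le_of_ne hα1 hne)
    -- The coefficient `Γ(1 - α)` makes the one-term series of index `1 - α` equal to 1, so the
    -- second factor is exactly the kernel `(t - u)^(-α)`.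
    refine (intervalIntegrable_mlSeries_mul_mlSeries hα hα hlt hv.shift
      (expBounded_single_zero (Real.Gamma (1 - α))) ht).congr fun s hs => ?_
    rw [Set.uIoc_of_le ht.le] at hs
    simp only [mlSeries_single_zero]
    rw [inv_mul_cancel₀ (Real.Gamma_pos_of_pos hlt).ne', mul_one,
      iteratedDeriv_one_eq_of_eq_mlSeries hα hv hx hs.1]
    exact mul_comm _ _

/-- For `α < 1` the normalized kernel has index `1 - α` and coefficients `1, 0, 0, …`, the unit of
the Cauchy product. Convolving it with the derivative, which has index `α`, restores index 1 and
keeps the shifted coefficients. For `α = 1` the derivative is already the answer. -/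
theorem caputoDeriv_eq_of_eq_mlSeries :
    caputoDeriv α x t = mlSeries α 1 (fun k => v (k + 1)) (t ^ α) := by
  have hc := natCeil_eq_one_of_pos_of_le_one hα hα1
  rw [caputoDeriv, hc, Nat.cast_one]
  split_ifs with h
  · rw [iteratedDeriv_one_eq_of_eq_mlSeries hα hv hx ht]
    subst h
    simp
  · have hlt : 0 < 1 - α := sub_pos.2 (lt_of_le_of_ne hα1 h)
    have hk := integral_mlSeries_mul_mlSeries hα hα hlt hv.shift
      (expBounded_single_zero 1) ht
    have hs : ∀ n, ∑ kl ∈ Finset.HasAntidiagonal.antidiagonal n,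
        v (kl.1 + 1) * (if kl.2 = 0 then (1 : ℝ) else 0) = v (n + 1) := by
      intro n
      rw [Finset.sum_eq_single (n, 0)]
      · simp
      · intro kl hkl hne
        rw [Finset.HasAntidiagonal.mem_antidiagonal] at hkl
        have : kl.2 ≠ 0 := fun h0 => hne (Prod.ext (by simpa [h0] using hkl) h0)
        simp [this]
      · simp
    simp only [hs, mlSeries_single_zero, add_sub_cancel, sub_self, Real.rpow_zero, one_mul,
      mul_one] at hk
    rw [← hk, ← intervalIntegral.integral_const_mul]
    rw [intervalIntegral.integral_of_le ht.le, intervalIntegral.integral_of_le ht.le]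
    refine setIntegral_congr_fun measurableSet_Ioc fun u hu => ?_
    rw [iteratedDeriv_one_eq_of_eq_mlSeries hα hv hx hu.1]
    ring

end

/-! ### The Mittag-Leffler distribution. -/

/-- A finite measure whose distribution function is the integral of a signed density integrates
bounded functions against that density. -/
theorem setIntegral_Iic_eq_of_real_Iic_eq {ν : Measure ℝ} [IsFiniteMeasure ν] {f : ℝ → ℝ}
    (hf : Measurable f) {t : ℝ} (hfi : IntegrableOn f (Set.Iic t))
    (hν : ∀ x ≤ t, ν.real (Set.Iic x) = ∫ u in Set.Iic x, f u) {h : ℝ → ℝ} (hh : Measurable h)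
    {C : ℝ} (hC : ∀ x, |h x| ≤ C) :
    ∫ u in Set.Iic t, h u ∂ν = ∫ u in Set.Iic t, f u * h u := by
  set V : Measure ℝ := volume.restrict (Set.Iic t) with hV
  have fin : ∀ g : ℝ → ℝ, Integrable g V →
      IsFiniteMeasure (V.withDensity fun u => ENNReal.ofReal (g u)) := fun g hg =>
    isFiniteMeasure_withDensity_ofReal hg.2
  have fp := fin f hfi
  have fm := fin (fun u => -f u) hfi.neg
  -- Moving the negative part of `f` to the other side gives an equality of positive measures, so
  -- positivity of the Mittag-Leffler density is never needed.
  have hmeas : ν.restrict (Set.Iic t) + V.withDensity (fun u => ENNReal.ofReal (-f u)) =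
      V.withDensity (fun u => ENNReal.ofReal (f u)) := by
    refine Measure.ext_of_Iic _ _ fun x => ?_
    rw [Measure.add_apply, Measure.restrict_apply measurableSet_Iic,
      withDensity_apply _ measurableSet_Iic, withDensity_apply _ measurableSet_Iic, hV,
      Measure.restrict_restrict measurableSet_Iic, Set.Iic_inter_Iic]
    have hi : IntegrableOn f (Set.Iic (x ⊓ t)) :=
      hfi.mono_set (Set.Iic_subset_Iic.2 inf_le_right)
    have hp := hi.2
    have key := integral_eq_lintegral_pos_part_sub_lintegral_neg_part hi
    rw [← hν _ inf_le_right] at key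
    have hpf : ∫⁻ u in Set.Iic (x ⊓ t), ENNReal.ofReal (f u) ≠ ⊤ := hi.lintegral_lt_top.ne
    have hmf : ∫⁻ u in Set.Iic (x ⊓ t), ENNReal.ofReal (-f u) ≠ ⊤ := hi.neg.lintegral_lt_top.ne
    rw [← ENNReal.toReal_eq_toReal_iff' (by finiteness) hpf,
      ENNReal.toReal_add (by finiteness) hmf, ← measureReal_def, key]
    ring
  have hbdd : ∀ (ρ : Measure ℝ) [IsFiniteMeasure ρ], Integrable h ρ := fun ρ _ =>
    Integrable.of_bound hh.aestronglyMeasurable C (Filter.Eventually.of_forall hC)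
  have hint := congrArg (fun ρ : Measure ℝ => ∫ u, h u ∂ρ) hmeas
  beta_reduce at hint
  rw [integral_add_measure (hbdd _) (hbdd _),
    integral_withDensity_eq_integral_toReal_smul (by fun_prop) (by simp),
    integral_withDensity_eq_integral_toReal_smul (by fun_prop) (by simp)] at hint
  have hfh : ∀ g : ℝ → ℝ, Integrable g V → Integrable (fun u => max (g u) 0 * h u) V :=
    fun g hg => hg.pos_part.mul_bdd (c := C) hh.aestronglyMeasurable
      (Filter.Eventually.of_forall hC)
  simp only [ENNReal.toReal_ofReal', smul_eq_mul] at hint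
  rw [eq_sub_of_add_eq hint, ← integral_sub (hfh f hfi) (hfh (fun u => -f u) hfi.neg)]
  refine integral_congr_ae (Filter.Eventually.of_forall fun u => ?_)
  beta_reduce
  rw [← sub_mul, max_zero_sub_max_neg_zero_eq_self]

theorem mittagLeffler_real_neg_mul (α β l x : ℝ) :
    mittagLeffler α β (-l * x) = mlSeries α β (fun k => (-l) ^ k) x := by
  simp only [mittagLeffler, mlSeries, smul_eq_mul, mul_pow]

section
variable {α : ℝ} (hα : 0 < α) {l : ℝ}

theorem mittagLefflerPDF_of_pos {x : ℝ} (hx : 0 < x) :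
    mittagLefflerPDF α l x = l * (x ^ (α - 1) * mlSeries α α (fun k => (-l) ^ k) (x ^ α)) := by
  rw [mittagLefflerPDF, if_pos hx, mittagLeffler_real_neg_mul, mul_assoc]

theorem mittagLefflerPDF_of_nonpos {x : ℝ} (hx : x ≤ 0) : mittagLefflerPDF α l x = 0 :=
  if_neg hx.not_gt

include hα

theorem measurable_mittagLefflerPDF : Measurable (mittagLefflerPDF α l) := by
  have h : Measurable fun x : ℝ =>
      l * (x ^ (α - 1) * mlSeries α α (fun k => (-l) ^ k) (x ^ α)) :=
    measurable_const.mul ((by fun_prop : Measurable fun x : ℝ => x ^ (α - 1)).mul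
      ((continuous_mlSeries hα hα (expBounded_pow _)).measurable.comp (by fun_prop)))
  have e : mittagLefflerPDF α l = Set.indicator (Set.Ioi 0) fun x : ℝ =>
      l * (x ^ (α - 1) * mlSeries α α (fun k => (-l) ^ k) (x ^ α)) := by
    ext x
    by_cases hx : 0 < x
    · rw [Set.indicator_of_mem (Set.mem_Ioi.2 hx), mittagLefflerPDF_of_pos hx]
    · rw [Set.indicator_of_notMem (by simpa using hx), mittagLefflerPDF_of_nonpos (not_lt.1 hx)]
  rw [e]
  exact h.indicator measurableSet_Ioi

theorem integrableOn_mittagLefflerPDF (t : ℝ) :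
    IntegrableOn (mittagLefflerPDF α l) (Set.Iic t) := by
  have h0 : IntegrableOn (mittagLefflerPDF α l) (Set.Iic 0) :=
    (integrableOn_zero (ε' := ℝ)).congr_fun (fun x hx => (mittagLefflerPDF_of_nonpos hx).symm)
      measurableSet_Iic
  rcases le_or_gt t 0 with ht | ht
  · exact h0.mono_set (Set.Iic_subset_Iic.2 ht)
  rw [← Set.Iic_union_Ioc_eq_Iic ht.le]
  refine h0.union ?_
  have h1 : Continuous fun u : ℝ => l * mlSeries α α (fun k => (-l) ^ k) (u ^ α) :=
    continuous_const.mul ((continuous_mlSeries hα hα (expBounded_pow _)).comp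
      (Real.continuous_rpow_const hα.le))
  have h2 := (intervalIntegral.intervalIntegrable_rpow' (a := 0) (b := t)
    (by linarith : -1 < α - 1)).mul_continuousOn h1.continuousOn
  rw [intervalIntegrable_iff_integrableOn_Ioc_of_le ht.le] at h2
  refine h2.congr_fun (fun x hx => ?_) measurableSet_Ioc
  rw [mittagLefflerPDF_of_pos hx.1]
  ring

omit hα in
theorem setIntegral_mittagLefflerPDF_mul {t : ℝ} (ht : 0 < t) (h : ℝ → ℝ) :
    ∫ u in Set.Iic t, mittagLefflerPDF α l u * h u =
      ∫ u in (0 : ℝ)..t, l * (u ^ (α - 1) * mlSeries α α (fun k => (-l) ^ k) (u ^ α)) * h u := by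
  rw [intervalIntegral.integral_of_le ht.le]
  have : ∫ u in Set.Iic t, mittagLefflerPDF α l u * h u =
      ∫ u in Set.Ioc 0 t, mittagLefflerPDF α l u * h u := by
    refine (setIntegral_eq_of_subset_of_forall_sdiff_eq_zero measurableSet_Iic
      Set.Ioc_subset_Iic_self fun x hx => ?_)
    have : x ≤ 0 := by
      by_contra h0
      exact hx.2 ⟨not_le.1 h0, hx.1⟩
    rw [mittagLefflerPDF_of_nonpos this, zero_mul]
  rw [this]
  refine setIntegral_congr_fun measurableSet_Ioc fun x hx => ?_
  rw [mittagLefflerPDF_of_pos hx.1]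

variable {ν : Measure ℝ} [IsProbabilityMeasure ν]
  (hν : ∀ x, ν.real (Set.Iic x) = ∫ u in Set.Iic x, mittagLefflerPDF α l u)

omit hα in
include hν in
theorem measure_Iic_zero_of_mittagLeffler : ν (Set.Iic 0) = 0 := by
  have h : ν.real (Set.Iic 0) = 0 := by
    rw [hν, setIntegral_congr_fun measurableSet_Iic
      fun x hx => mittagLefflerPDF_of_nonpos (α := α) (l := l) hx]
    simp
  rwa [measureReal_eq_zero_iff] at h

include hν

theorem setIntegral_Iic_of_mittagLeffler {t : ℝ} (ht : 0 < t) {h : ℝ → ℝ} (hh : Measurable h)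
    {C : ℝ} (hC : ∀ x, |h x| ≤ C) :
    ∫ u in Set.Iic t, h u ∂ν =
      ∫ u in (0 : ℝ)..t, l * (u ^ (α - 1) * mlSeries α α (fun k => (-l) ^ k) (u ^ α)) * h u := by
  rw [setIntegral_Iic_eq_of_real_Iic_eq (measurable_mittagLefflerPDF hα)
    (integrableOn_mittagLefflerPDF hα t) (fun x _ => hν x) hh hC,
    setIntegral_mittagLefflerPDF_mul ht]

/-- The renewal equation for the constant function 1, with `a = -l`, says that this series and the
distribution function add up to 1. -/
theorem real_Ioi_of_mittagLeffler {t : ℝ} (ht : 0 ≤ t) :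
    ν.real (Set.Ioi t) = mlSeries α 1 (fun k => (-l) ^ k) (t ^ α) := by
  rcases ht.eq_or_lt with rfl | ht
  · rw [Real.zero_rpow hα.ne', mlSeries_zero, ← Set.compl_Iic,
      probReal_compl_eq_one_sub measurableSet_Iic, measureReal_def,
      measure_Iic_zero_of_mittagLeffler hν]
    simp
  rw [← Set.compl_Iic, probReal_compl_eq_one_sub measurableSet_Iic]
  have h1 := mlSeries_renewal hα (expBounded_single_zero 1) (-l) ht
  have h2 := setIntegral_Iic_of_mittagLeffler hα hν ht (h := fun _ => 1) measurable_const
    (C := 1) (by simp)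
  have e : (fun k : ℕ => (if k + 1 = 0 then (1 : ℝ) else 0) - -l * if k = 0 then 1 else 0) =
      fun k => if k = 0 then l else 0 := by
    ext k
    by_cases hk : k = 0 <;> simp [hk]
  rw [e] at h1
  simp only [mlSeries_single_zero, Real.Gamma_one, inv_one, one_mul, if_true] at h1
  rw [setIntegral_const, smul_eq_mul, mul_one] at h2
  rw [h2]
  simp only [mul_one, mul_comm l]
  linarith

end

/-! ### The matrix Mittag-Leffler function and its Markov renewal equation. -/

theorem Matrix.exists_abs_pow_apply_le {m : Type*} [Fintype m] [DecidableEq m]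
    (T : Matrix m m ℝ) : ∃ R : ℝ, 0 ≤ R ∧ ∀ n i j, |(T ^ n) i j| ≤ R ^ n := by
  refine ⟨∑ i, ∑ j, |T i j|, by positivity, fun n => ?_⟩
  induction n with
  | zero =>
    intro i j
    rw [pow_zero, pow_zero, Matrix.one_apply]
    split_ifs <;> simp
  | succ n ih =>
    intro i j
    rw [pow_succ', Matrix.mul_apply, pow_succ']
    refine (Finset.abs_sum_le_sum_abs _ _).trans ?_
    calc ∑ l, |T i l * (T ^ n) l j|
        ≤ ∑ l, |T i l| * (∑ i, ∑ j, |T i j|) ^ n := by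
          refine Finset.sum_le_sum fun l _ => ?_
          rw [abs_mul]
          exact mul_le_mul_of_nonneg_left (ih l j) (abs_nonneg _)
      _ = (∑ l, |T i l|) * (∑ i, ∑ j, |T i j|) ^ n := by rw [Finset.sum_mul]
      _ ≤ _ := by
          refine mul_le_mul_of_nonneg_right ?_ (by positivity)
          exact Finset.single_le_sum (f := fun i => ∑ j, |T i j|)
            (fun i _ => by positivity) (Finset.mem_univ i)

theorem expBounded_matrix_pow {m : Type*} [Fintype m] [DecidableEq m] (T : Matrix m m ℝ)
    (i j : m) : ExpBounded fun n => (T ^ n) i j := by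
  obtain ⟨R, hR, h⟩ := T.exists_abs_pow_apply_le
  exact ⟨1, R, zero_le_one, hR, fun n => by simpa using h n i j⟩

section
variable {m : Type*} [Fintype m] [DecidableEq m] {α : ℝ} (hα : 0 < α)
include hα

theorem mittagLeffler_smul_matrix_apply {β : ℝ} (hβ : 0 < β) (T : Matrix m m ℝ) (z : ℝ) (i j : m) :
    mittagLeffler α β (z • T) i j = mlSeries α β (fun n => (T ^ n) i j) z := by
  have hs : ∀ i j, Summable fun n : ℕ =>
      ((Real.Gamma (α * n + β))⁻¹ • (z • T) ^ n) i j := fun i j => by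
    refine ((expBounded_matrix_pow T i j).summable_norm hα hβ z).of_norm.congr fun n => ?_
    simp only [smul_pow, Matrix.smul_apply, smul_eq_mul]
    ring
  have hs1 : Summable fun n : ℕ => (Real.Gamma (α * n + β))⁻¹ • (z • T) ^ n :=
    Pi.summable.2 fun i => Pi.summable.2 fun j => hs i j
  refine (Pi.hasSum.1 (Pi.hasSum.1 hs1.hasSum i) j).tsum_eq.symm.trans (tsum_congr fun n => ?_)
  simp only [smul_pow, Matrix.smul_apply, smul_eq_mul]
  ring

theorem mlSeries_sum_mul {ι : Type*} (s : Finset ι) {v : ι → ℕ → ℝ} (hv : ∀ i, ExpBounded (v i))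
    (c : ι → ℝ) {β : ℝ} (hβ : 0 < β) (z : ℝ) :
    mlSeries α β (fun n => ∑ i ∈ s, c i * v i n) z = ∑ i ∈ s, c i * mlSeries α β (v i) z := by
  simp only [mlSeries, ← tsum_mul_left]
  rw [← Summable.tsum_finsetSum fun i _ => ((hv i).summable_norm hα hβ z).of_norm.mul_left _]
  refine tsum_congr fun n => ?_
  rw [Finset.sum_mul, Finset.mul_sum]
  exact Finset.sum_congr rfl fun i _ => by ring

/-- The Markov renewal equation of the matrix Mittag-Leffler function. -/
theorem mlSeries_matrix_renewal {lam : m → ℝ} {q T : Matrix m m ℝ}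
    (hT : ∀ k l, T k l = lam k * q k l - if k = l then lam k else 0)
    {ν : m → Measure ℝ} [∀ k, IsProbabilityMeasure (ν k)]
    (hν : ∀ k x, (ν k).real (Set.Iic x) = ∫ u in Set.Iic x, mittagLefflerPDF α (lam k) u)
    {t : ℝ} (ht : 0 ≤ t) (k j : m) :
    mlSeries α 1 (fun n => (T ^ n) k j) (t ^ α) =
      (if k = j then (ν k).real (Set.Ioi t) else 0) +
        ∑ l, q k l * ∫ u in Set.Icc 0 t, mlSeries α 1 (fun n => (T ^ n) l j) ((t - u) ^ α) ∂(ν k) := by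
  have hcont : ∀ l, Continuous fun u : ℝ => mlSeries α 1 (fun n => (T ^ n) l j) ((t - u) ^ α) :=
    fun l => (continuous_mlSeries hα one_pos (expBounded_matrix_pow T l j)).comp
      ((Real.continuous_rpow_const hα.le).comp (by fun_prop))
  rcases ht.eq_or_lt with rfl | ht
  -- At `t = 0` the integrals vanish because `ν k` has no atom at 0.
  · have h0 : ∀ h : ℝ → ℝ, ∫ u in Set.Icc 0 0, h u ∂(ν k) = 0 := fun h => by
      rw [Measure.restrict_eq_zero.2, integral_zero_measure]
      exact measure_mono_null Set.Icc_subset_Iic_self (measure_Iic_zero_of_mittagLeffler (hν k))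
    simp only [h0]
    rw [real_Ioi_of_mittagLeffler hα (hν k) le_rfl, Real.zero_rpow hα.ne', mlSeries_zero,
      mlSeries_zero]
    simp [Matrix.one_apply]
  have hI : ∀ l, ∫ u in Set.Icc 0 t, mlSeries α 1 (fun n => (T ^ n) l j) ((t - u) ^ α) ∂(ν k) =
      ∫ u in (0 : ℝ)..t, lam k * (u ^ (α - 1) * mlSeries α α (fun k' => (-lam k) ^ k') (u ^ α)) *
        mlSeries α 1 (fun n => (T ^ n) l j) ((t - u) ^ α) := by
    intro l
    set g : ℝ → ℝ := fun u => mlSeries α 1 (fun n => (T ^ n) l j) ((t - u) ^ α) with hg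
    obtain ⟨C, hC⟩ := (isCompact_Icc (a := (0 : ℝ)) (b := t)).exists_bound_of_continuousOn
      (hcont l).continuousOn
    have hC0 : 0 ≤ C := (norm_nonneg _).trans (hC 0 ⟨le_rfl, ht.le⟩)
    -- The integrand is cut off outside `[0, t]` because the density formula asks for a globally
    -- bounded function.
    have h := setIntegral_Iic_of_mittagLeffler hα (hν k) ht
      (h := (Set.Icc 0 t).indicator g) ((hcont l).measurable.indicator measurableSet_Icc) (C := C)
      (fun x => by
        by_cases hx : x ∈ Set.Icc 0 t
        · rw [Set.indicator_of_mem hx]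
          exact hC x hx
        · rw [Set.indicator_of_notMem hx]
          simpa using hC0)
    rw [setIntegral_indicator measurableSet_Icc,
      Set.inter_eq_self_of_subset_right Set.Icc_subset_Iic_self] at h
    rw [h]
    refine intervalIntegral.integral_congr fun u hu => ?_
    rw [Set.uIcc_of_le ht.le] at hu
    simp only [Set.indicator_of_mem hu]
    rfl
  have hint : ∀ l, IntervalIntegrable (fun u : ℝ => lam k * (u ^ (α - 1) *
      mlSeries α α (fun k' => (-lam k) ^ k') (u ^ α)) *
        mlSeries α 1 (fun n => (T ^ n) l j) ((t - u) ^ α)) volume 0 t := by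
    intro l
    have h := (intervalIntegrable_mlSeries_mul_mlSeries hα hα one_pos (expBounded_pow (-lam k))
      (expBounded_matrix_pow T l j) ht).const_mul (lam k)
    simpa [mul_assoc] using h
  simp only [hI]
  rw [mlSeries_renewal hα (expBounded_matrix_pow T k j) (-lam k) ht,
    real_Ioi_of_mittagLeffler hα (hν k) ht.le]
  congr 1
  · simp [Matrix.one_apply]
  · simp only [← intervalIntegral.integral_const_mul]
    rw [← intervalIntegral.integral_finsetSum fun l _ => (hint l).const_mul _]
    refine intervalIntegral.integral_congr fun u _ => ?_
    -- Expanding `T^(n+1) = T * T^n` along row `k`, the `-lam k` on the diagonal cancels and only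
    -- the jump rates remain.
    have e : (fun n => (T ^ (n + 1)) k j - -lam k * (T ^ n) k j) =
        fun n => ∑ l, (lam k * q k l) * (T ^ n) l j := by
      ext n
      simp [pow_succ', Matrix.mul_apply, hT, sub_mul, Finset.sum_sub_distrib]
    rw [e, mlSeries_sum_mul hα Finset.univ (fun l => expBounded_matrix_pow T l j) _ one_pos,
      Finset.mul_sum]
    exact Finset.sum_congr rfl fun l _ => by ring

end

/-! ### Iteration of the renewal equation over the jumps. -/

theorem lintegral_exp_neg_lt_one {ν : Measure ℝ} [IsProbabilityMeasure ν] (hν : ν (Set.Iic 0) = 0) :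
    ∫⁻ u, ENNReal.ofReal (Real.exp (-u)) ∂ν < 1 := by
  have hpos : ∀ᵐ u ∂ν, 0 < u := by
    have : ∀ᵐ u ∂ν, u ∉ Set.Iic (0 : ℝ) := measure_eq_zero_iff_ae_notMem.1 hν
    filter_upwards [this] with u hu using not_le.1 hu
  have hlt : ∀ᵐ u ∂ν, ENNReal.ofReal (Real.exp (-u)) < 1 := by
    filter_upwards [hpos] with u hu
    rw [← ENNReal.ofReal_one]
    exact (ENNReal.ofReal_lt_ofReal_iff one_pos).2 (Real.exp_lt_one_iff.2 (by linarith))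
  have hle : ∫⁻ u, ENNReal.ofReal (Real.exp (-u)) ∂ν ≤ ∫⁻ _, 1 ∂ν :=
    lintegral_mono_ae (hlt.mono fun u hu => hu.le)
  simpa using lintegral_strict_mono (IsProbabilityMeasure.ne_zero ν) (by fun_prop)
    (ne_top_of_le_ne_top (by simp) hle) hlt

/-- A sequence of families of measures on the half line that is obtained by successive convolution
with a sub-stochastic semi-Markov kernel `q k l • ν k`. -/
structure IsSemiMarkovConvolution {m : Type*} [Fintype m] (q : Matrix m m ℝ) (ν : m → Measure ℝ)
    (r : ℕ → m → Measure ℝ) : Prop where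
  nonneg : ∀ k l, 0 ≤ q k l
  sum_le : ∀ k, ∑ l, q k l ≤ 1
  prob : ∀ k, IsProbabilityMeasure (ν k)
  pos : ∀ k, ν k (Set.Iic 0) = 0
  finite : ∀ n k, IsFiniteMeasure (r n k)
  support : ∀ n k, r n k (Set.Iio 0) = 0
  step : ∀ n l, r (n + 1) l = ∑ k, (ENNReal.ofReal (q k l) • r n k) ∗ ν k

namespace IsSemiMarkovConvolution

variable {m : Type*} [Fintype m] {q : Matrix m m ℝ} {ν : m → Measure ℝ}
  {r : ℕ → m → Measure ℝ} (h : IsSemiMarkovConvolution q ν r)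
include h

theorem ae_nonneg (n : ℕ) (k : m) : ∀ᵐ s ∂(r n k), 0 ≤ s := by
  have : ∀ᵐ s ∂(r n k), s ∉ Set.Iio (0 : ℝ) := measure_eq_zero_iff_ae_notMem.1 (h.support n k)
  filter_upwards [this] with s hs using not_lt.1 hs

theorem ae_pos (k : m) : ∀ᵐ u ∂(ν k), 0 < u := by
  have : ∀ᵐ u ∂(ν k), u ∉ Set.Iic (0 : ℝ) := measure_eq_zero_iff_ae_notMem.1 (h.pos k)
  filter_upwards [this] with u hu using not_le.1 hu

/-- The integral of `exp (-s)` is multiplicative under convolution, and `q` is sub-stochastic. Each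
jump therefore contracts the total by the largest Laplace transform at 1 of the `ν k`, which is
below 1 because there are finitely many states. -/
theorem tendsto_sum_lintegral_exp_neg :
    Filter.Tendsto (fun n => ∑ k, ∫⁻ s, ENNReal.ofReal (Real.exp (-s)) ∂(r n k)) Filter.atTop
      (nhds 0) := by
  set L : ℕ → m → ENNReal := fun n k => ∫⁻ s, ENNReal.ofReal (Real.exp (-s)) ∂(r n k) with hL
  set ρ : m → ENNReal := fun k => ∫⁻ u, ENNReal.ofReal (Real.exp (-u)) ∂(ν k) with hρ
  have := h.prob
  have := h.finite
  have hstep : ∀ n l, L (n + 1) l = ∑ k, ENNReal.ofReal (q k l) * (L n k * ρ k) := by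
    intro n l
    simp only [hL, hρ, h.step]
    rw [lintegral_finsetSum_measure]
    refine Finset.sum_congr rfl fun k _ => ?_
    rw [Measure.lintegral_conv (by fun_prop), lintegral_smul_measure, smul_eq_mul]
    congr 1
    rw [← lintegral_mul_const _ (by fun_prop)]
    refine lintegral_congr fun s => ?_
    rw [← lintegral_const_mul _ (by fun_prop)]
    refine lintegral_congr fun u => ?_
    rw [← ENNReal.ofReal_mul (by positivity), ← Real.exp_add, neg_add]
  set R : ENNReal := Finset.univ.sup ρ with hR
  have hR1 : R < 1 := (Finset.sup_lt_iff (by simp)).2 fun k _ => lintegral_exp_neg_lt_one (h.pos k)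
  have hq : ∀ k, ∑ l, ENNReal.ofReal (q k l) ≤ 1 := fun k => by
    rw [← ENNReal.ofReal_sum_of_nonneg fun l _ => h.nonneg k l, ← ENNReal.ofReal_one]
    exact ENNReal.ofReal_le_ofReal (h.sum_le k)
  have hdec : ∀ n, ∑ l, L (n + 1) l ≤ R * ∑ k, L n k := by
    intro n
    simp only [hstep]
    rw [Finset.sum_comm, Finset.mul_sum]
    refine Finset.sum_le_sum fun k _ => ?_
    rw [← Finset.sum_mul]
    calc (∑ l, ENNReal.ofReal (q k l)) * (L n k * ρ k) ≤ 1 * (L n k * R) := by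
          gcongr
          · exact hq k
          · exact Finset.le_sup (Finset.mem_univ k)
      _ = R * L n k := by ring
  have hpow : ∀ n, ∑ k, L n k ≤ R ^ n * ∑ k, L 0 k := by
    intro n
    induction n with
    | zero => simp
    | succ n ih => exact (hdec n).trans ((mul_le_mul_right ih R).trans_eq (by ring))
  have hfin : ∑ k, L 0 k ≠ ⊤ := by
    refine ENNReal.sum_ne_top.2 fun k _ => ne_top_of_le_ne_top (measure_ne_top (r 0 k) Set.univ) ?_
    rw [← lintegral_one]
    refine lintegral_mono_ae ((h.ae_nonneg 0 k).mono fun s hs => ?_)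
    rw [← ENNReal.ofReal_one]
    exact ENNReal.ofReal_le_ofReal (Real.exp_le_one_iff.2 (by linarith))
  have hlim := ENNReal.Tendsto.mul_const (ENNReal.tendsto_pow_atTop_nhds_zero_of_lt_one hR1)
    (Or.inr hfin)
  rw [zero_mul] at hlim
  exact tendsto_of_tendsto_of_tendsto_of_le_of_le tendsto_const_nhds hlim (fun n => zero_le) hpow

/-- Iterating a Markov renewal equation represents its locally bounded solution as the sum over
the number of renewals. -/
theorem hasSum_of_renewal [DecidableEq m] {e : m → ℝ → ℝ} (he : ∀ k, Continuous (e k)) (j : m)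
    (hren : ∀ k, ∀ t, 0 ≤ t → e k t = (if k = j then (ν k).real (Set.Ioi t) else 0) +
      ∑ l, q k l * ∫ u in Set.Icc 0 t, e l (t - u) ∂(ν k)) {t : ℝ} (ht : 0 ≤ t) :
    HasSum (fun n => ((r n j).prod (ν j)).real {x : ℝ × ℝ | x.1 ≤ t ∧ t < x.1 + x.2})
      (∑ k, ∫ s in Set.Icc 0 t, e k (t - s) ∂(r 0 k)) := by
  have := h.prob
  have := h.finite
  -- `g k s` is the value still to come when the chain enters `k` at time `s`; it is zero once `s >
  -- t`.
  set g : m → ℝ → ℝ := fun k => (Set.Icc 0 t).indicator fun s => e k (t - s) with hg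
  have hgm : ∀ k, Measurable (g k) := fun k => by
    have hc : Continuous fun s => e k (t - s) := (he k).comp (by fun_prop)
    exact hc.measurable.indicator measurableSet_Icc
  obtain ⟨C, hC0, hC⟩ : ∃ C, 0 ≤ C ∧ ∀ k s, |g k s| ≤ C := by
    have : ∀ k, ∃ C, ∀ s ∈ Set.Icc 0 t, ‖e k (t - s)‖ ≤ C := fun k =>
      isCompact_Icc.exists_bound_of_continuousOn (by have := he k; fun_prop)
    choose C hC using this
    have h0 : ∀ k, 0 ≤ C k := fun k => (norm_nonneg _).trans (hC k 0 ⟨le_rfl, ht⟩)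
    refine ⟨∑ k, C k, Finset.sum_nonneg fun k _ => h0 k, fun k s => ?_⟩
    refine le_trans ?_ (Finset.single_le_sum (fun k _ => h0 k) (Finset.mem_univ k))
    by_cases hs : s ∈ Set.Icc 0 t
    · simpa [hg, hs] using hC k s hs
    · simpa [hg, hs] using h0 k
  have hgi : ∀ (ρ : Measure ℝ) [IsFiniteMeasure ρ] k, Integrable (g k) ρ := fun ρ _ k =>
    Integrable.of_bound (hgm k).aestronglyMeasurable C (Filter.Eventually.of_forall (hC k))
  set D : Set (ℝ × ℝ) := {x | x.1 ≤ t ∧ t < x.1 + x.2} with hD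
  have hDm : MeasurableSet D :=
    (measurableSet_le measurable_fst measurable_const).inter
      (measurableSet_lt measurable_const (measurable_fst.add measurable_snd))
  -- In terms of the elapsed time `s` the renewal equation holds without the restriction `s ≤ t`,
  -- since beyond `t` both sides vanish.
  have hgren : ∀ k s, 0 ≤ s → g k s = (if k = j then (ν k).real (Prod.mk s ⁻¹' D) else 0) +
      ∑ l, q k l * ∫ u, g l (s + u) ∂(ν k) := by
    intro k s hs
    rcases le_or_gt s t with hst | hst
    · have e1 : g k s = e k (t - s) := Set.indicator_of_mem (show s ∈ Set.Icc 0 t from ⟨hs, hst⟩) _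
      have e2 : Prod.mk s ⁻¹' D = Set.Ioi (t - s) := by
        ext u
        simp only [hD, Set.mem_preimage, Set.mem_ofPred_eq, hst, true_and, Set.mem_Ioi]
        constructor <;> intro h <;> linarith
      rw [e1, e2, hren k _ (sub_nonneg.2 hst)]
      congr 1
      refine Finset.sum_congr rfl fun l _ => ?_
      rw [← integral_indicator measurableSet_Icc]
      congr 1
      refine integral_congr_ae ((h.ae_pos k).mono fun u hu => ?_)
      by_cases hu2 : u ≤ t - s
      · have m1 : u ∈ Set.Icc 0 (t - s) := ⟨hu.le, hu2⟩
        have m2 : s + u ∈ Set.Icc 0 t := ⟨by positivity, by linarith⟩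
        simp only [hg, Set.indicator_of_mem m1, Set.indicator_of_mem m2]
        congr 1; ring
      · have m1 : u ∉ Set.Icc 0 (t - s) := fun hm => hu2 hm.2
        have m2 : s + u ∉ Set.Icc 0 t := fun hm => hu2 (by linarith [hm.2])
        simp only [hg, Set.indicator_of_notMem m1, Set.indicator_of_notMem m2]
    · have e1 : g k s = 0 := Set.indicator_of_notMem (fun hm => hst.not_ge hm.2) _
      have e2 : Prod.mk s ⁻¹' D = ∅ := by
        ext u
        simp [hD, hst]
      have e3 : ∀ l, ∫ u, g l (s + u) ∂(ν k) = 0 := fun l => by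
        refine integral_eq_zero_of_ae ((h.ae_pos k).mono fun u hu => ?_)
        exact Set.indicator_of_notMem (fun hm => by linarith [hm.2]) _
      simp [e1, e2, e3]
  set Φ : ℕ → ℝ := fun n => ∑ k, ∫ s, g k s ∂(r n k) with hΦ
  have hprod : ∀ n, ((r n j).prod (ν j)).real D = ∫ s, (ν j).real (Prod.mk s ⁻¹' D) ∂(r n j) := by
    intro n
    rw [measureReal_def, Measure.prod_apply hDm, integral_eq_lintegral_of_nonneg_ae
      (Filter.Eventually.of_forall fun s => measureReal_nonneg)
      (measurable_measure_prodMk_left hDm).ennreal_toReal.aestronglyMeasurable]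
    simp
  have hconv : ∀ n k l, ∫ s, g l s ∂((ENNReal.ofReal (q k l) • r n k) ∗ ν k) =
      q k l * ∫ s, ∫ u, g l (s + u) ∂(ν k) ∂(r n k) := by
    intro n k l
    have : IsFiniteMeasure (ENNReal.ofReal (q k l) • r n k) :=
      Measure.smul_finite _ ENNReal.ofReal_ne_top
    rw [integral_conv (hgi _ l), integral_smul_measure, ENNReal.toReal_ofReal (h.nonneg k l),
      smul_eq_mul]
  have hinner : ∀ n k l, Integrable (fun s => ∫ u, g l (s + u) ∂(ν k)) (r n k) := fun n k l => by
    refine Integrable.of_bound ?_ C (Filter.Eventually.of_forall fun s => ?_)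
    · have : StronglyMeasurable (Function.uncurry fun s u => g l (s + u)) :=
        ((hgm l).comp (by fun_prop : Measurable fun x : ℝ × ℝ => x.1 + x.2)).stronglyMeasurable
      exact this.integral_prod_right.aestronglyMeasurable
    · refine (norm_integral_le_of_norm_le_const (C := C)
        (Filter.Eventually.of_forall fun u => hC l _)).trans_eq (by simp)
  have hfirst : ∀ n k, Integrable
      (fun s => if k = j then (ν k).real (Prod.mk s ⁻¹' D) else 0) (r n k) := fun n k => by
    refine Integrable.of_bound ?_ 1 (Filter.Eventually.of_forall fun s => ?_)
    · split_ifs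
      · exact (measurable_measure_prodMk_left hDm).ennreal_toReal.aestronglyMeasurable
      · exact aestronglyMeasurable_const
    · split_ifs
      · rw [Real.norm_of_nonneg measureReal_nonneg]
        exact measureReal_le_one
      · simp
  -- One renewal splits off the mass of being in `j` at time `t` after exactly `n` jumps; `Φ` is
  -- thus the remainder of the series.
  have hΦstep : ∀ n, Φ n = ((r n j).prod (ν j)).real D + Φ (n + 1) := by
    intro n
    have e1 : ∀ k, ∫ s, g k s ∂(r n k) =
        (if k = j then ((r n j).prod (ν j)).real D else 0) +
          ∑ l, q k l * ∫ s, ∫ u, g l (s + u) ∂(ν k) ∂(r n k) := by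
      intro k
      rw [integral_congr_ae ((h.ae_nonneg n k).mono fun s hs => hgren k s hs),
        integral_add (hfirst n k) (integrable_finsetSum _ fun l _ => (hinner n k l).const_mul _),
        integral_finsetSum _ fun l _ => (hinner n k l).const_mul _]
      congr 1
      · split_ifs with hkj
        · rw [hkj, hprod]
        · simp
      · exact Finset.sum_congr rfl fun l _ => integral_const_mul _ _
    have e2 : ∀ l, ∫ s, g l s ∂(r (n + 1) l) =
        ∑ k, q k l * ∫ s, ∫ u, g l (s + u) ∂(ν k) ∂(r n k) := by
      intro l
      rw [h.step, integral_finsetSum_measure]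
      · exact Finset.sum_congr rfl fun k _ => hconv n k l
      · intro k _
        have : IsFiniteMeasure (ENNReal.ofReal (q k l) • r n k) :=
          Measure.smul_finite _ ENNReal.ofReal_ne_top
        exact hgi _ l
    simp only [hΦ, e1, e2]
    rw [Finset.sum_add_distrib, Finset.sum_ite_eq' Finset.univ j, if_pos (Finset.mem_univ j),
      Finset.sum_comm]
  have hΦlim : Filter.Tendsto Φ Filter.atTop (nhds 0) := by
    -- On the support of `g` one has `s ≤ t`, hence `1 ≤ exp (t - s)`.
    have hb : ∀ n, ‖Φ n‖ₑ ≤ ENNReal.ofReal (C * Real.exp t) *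
        ∑ k, ∫⁻ s, ENNReal.ofReal (Real.exp (-s)) ∂(r n k) := by
      intro n
      refine (enorm_sum_le _ _).trans ?_
      rw [Finset.mul_sum]
      refine Finset.sum_le_sum fun k _ => (enorm_integral_le_lintegral_enorm _).trans ?_
      rw [← lintegral_const_mul _ (by fun_prop)]
      refine lintegral_mono fun s => ?_
      rw [← ENNReal.ofReal_mul (by positivity), mul_assoc, ← Real.exp_add, ← ofReal_norm]
      refine ENNReal.ofReal_le_ofReal ?_
      by_cases hs : s ∈ Set.Icc 0 t
      · calc ‖g k s‖ ≤ C * 1 := by rw [mul_one]; exact hC k s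
          _ ≤ _ := by
            gcongr
            exact Real.one_le_exp (by linarith [hs.2])
      · have : g k s = 0 := Set.indicator_of_notMem hs _
        rw [this, norm_zero]
        positivity
    have hlim := ENNReal.Tendsto.const_mul (a := ENNReal.ofReal (C * Real.exp t))
      h.tendsto_sum_lintegral_exp_neg (Or.inr ENNReal.ofReal_ne_top)
    rw [mul_zero] at hlim
    rw [tendsto_zero_iff_enorm_tendsto_zero]
    exact tendsto_of_tendsto_of_tendsto_of_le_of_le tendsto_const_nhds hlim
      (fun n => zero_le) hb
  have hΦ0 : Φ 0 = ∑ k, ∫ s in Set.Icc 0 t, e k (t - s) ∂(r 0 k) := by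
    simp only [hΦ, hg, integral_indicator measurableSet_Icc]
  rw [hasSum_iff_tendsto_nat_of_nonneg fun n => measureReal_nonneg, ← hΦ0]
  have hpart : ∀ n, ∑ i ∈ Finset.range n, ((r i j).prod (ν j)).real D = Φ 0 - Φ n := by
    intro n
    induction n with
    | zero => simp
    | succ n ih =>
      rw [Finset.sum_range_succ, ih]
      linarith [hΦstep n]
  simp only [hpart]
  simpa using tendsto_const_nhds.sub hΦlim

end IsSemiMarkovConvolution

/-! ### Jump times and the state at time `t`. -/

/-- The jump time as a function of the sojourn variables along a fixed trajectory of states. -/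
noncomputable def trajectoryJumpTime {p : ℕ} (y : ℕ → Fin (p + 1)) (n : ℕ)
    (z : Fin p × ℕ → ℝ) : ENNReal :=
  ∑ k ∈ Finset.range n,
    Fin.lastCases (motive := fun _ => ENNReal) ⊤ (fun i => ENNReal.ofReal (z (i, k))) (y k)

section
variable {Ω : Type*} {p : ℕ} {Y : ℕ → Ω → Fin (p + 1)} {Z : Fin p → ℕ → Ω → ℝ}

theorem jumpTime_succ (n : ℕ) (ω : Ω) :
    jumpTime Y Z (n + 1) ω = jumpTime Y Z n ω + sojourn Y Z n ω :=
  Finset.sum_range_succ _ _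

theorem jumpTime_zero (ω : Ω) : jumpTime Y Z 0 ω = 0 := rfl

theorem jumpTime_mono (ω : Ω) : Monotone fun n => jumpTime Y Z n ω :=
  monotone_nat_of_le_succ fun n => by rw [jumpTime_succ]; exact le_self_add

theorem sojourn_of_eq_castSucc {n : ℕ} {ω : Ω} {k : Fin p} (h : Y n ω = k.castSucc) :
    sojourn Y Z n ω = ENNReal.ofReal (Z k n ω) := by
  rw [sojourn, h, Fin.lastCases_castSucc]

theorem sojourn_of_eq_last {n : ℕ} {ω : Ω} (h : Y n ω = Fin.last p) : sojourn Y Z n ω = ⊤ := by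
  rw [sojourn, h, Fin.lastCases_last]

theorem jumpTime_eq_trajectoryJumpTime {y : ℕ → Fin (p + 1)} {n : ℕ} {ω : Ω}
    (h : ∀ k < n, Y k ω = y k) :
    jumpTime Y Z n ω = trajectoryJumpTime y n fun a => Z a.1 a.2 ω :=
  Finset.sum_congr rfl fun k hk => by rw [sojourn, h k (Finset.mem_range.1 hk)]

/-- The process is in state `j` at time `t` exactly if it is there after some number of jumps. -/
theorem semiMarkovProcess_eq_some_iff {t : ℝ} {ω : Ω} {j : Fin (p + 1)} :
    semiMarkovProcess Y Z t ω = some j ↔ ∃ n, Y n ω = j ∧ jumpTime Y Z n ω ≤ ENNReal.ofReal t ∧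
      ENNReal.ofReal t < jumpTime Y Z (n + 1) ω := by
  classical
  unfold semiMarkovProcess
  constructor
  · intro h
    split_ifs at h with hex
    exact ⟨hex.choose, Option.some.inj h, hex.choose_spec⟩
  · rintro ⟨n, hn, h1, h2⟩
    have hex : ∃ n, jumpTime Y Z n ω ≤ ENNReal.ofReal t ∧
        ENNReal.ofReal t < jumpTime Y Z (n + 1) ω := ⟨n, h1, h2⟩
    rw [dif_pos hex]
    obtain ⟨h3, h4⟩ := hex.choose_spec
    have : hex.choose = n := by
      refine le_antisymm ?_ ?_ <;> by_contra hlt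
      · exact ((h2.trans_le (jumpTime_mono ω (by omega : n + 1 ≤ hex.choose))).trans_le h3).false
      · exact ((h4.trans_le (jumpTime_mono ω (by omega : hex.choose + 1 ≤ n))).trans_le h1).false
    rw [this, hn]

theorem jumpTime_interval_unique {t : ENNReal} {ω : Ω} {n n' : ℕ}
    (h1 : jumpTime Y Z n ω ≤ t) (h2 : t < jumpTime Y Z (n + 1) ω)
    (h3 : jumpTime Y Z n' ω ≤ t) (h4 : t < jumpTime Y Z (n' + 1) ω) : n = n' := by
  refine le_antisymm ?_ ?_ <;> by_contra hlt
  · exact ((h4.trans_le (jumpTime_mono ω (by omega : n' + 1 ≤ n))).trans_le h1).false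
  · exact ((h2.trans_le (jumpTime_mono ω (by omega : n + 1 ≤ n'))).trans_le h3).false

end

theorem measurable_lastCases_top {p : ℕ} {X : Type*} [MeasurableSpace X] {f : Fin p → X → ℝ}
    (hf : ∀ i, Measurable (f i)) (e : Fin (p + 1)) :
    Measurable fun x => Fin.lastCases (motive := fun _ => ENNReal) ⊤
      (fun i => ENNReal.ofReal (f i x)) e := by
  induction e using Fin.lastCases with
  | last => simp only [Fin.lastCases_last]; exact measurable_const
  | cast i => simp only [Fin.lastCases_castSucc]; exact (hf i).ennreal_ofReal

theorem measurable_trajectoryJumpTime {p : ℕ} (y : ℕ → Fin (p + 1)) (n : ℕ) :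
    Measurable (trajectoryJumpTime y n) :=
  Finset.measurable_sum _ fun k _ => measurable_lastCases_top (fun i => measurable_pi_apply (i, k)) _

/-! ### Independence and the Markov property at the jumps. -/

namespace IsMLSemiMarkovData

variable {Ω : Type*} [MeasurableSpace Ω] {p : ℕ} {μ : Measure Ω} {α : ℝ} {lam : Fin p → ℝ}
  {Q : Matrix (Fin (p + 1)) (Fin (p + 1)) ℝ} {Y : ℕ → Ω → Fin (p + 1)} {Z : Fin p → ℕ → Ω → ℝ}
  (h : IsMLSemiMarkovData μ α lam Q Y Z)
include h

theorem measurable_chain (n : ℕ) : Measurable (Y n) := h.markov.1 n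

theorem measurable_variable (k : Fin p) (n : ℕ) : Measurable (Z k n) := (h.law k n).1

theorem measurable_sojourn (n : ℕ) : Measurable (sojourn Y Z n) := by
  have hm : Measurable fun x : Fin (p + 1) × Ω =>
      Fin.lastCases (motive := fun _ => ENNReal) ⊤ (fun i => ENNReal.ofReal (Z i n x.2)) x.1 :=
    measurable_from_prod_countable_right fun e =>
      measurable_lastCases_top (fun i => h.measurable_variable i n) e
  exact hm.comp ((h.measurable_chain n).prodMk measurable_id)

theorem measurable_jumpTime (n : ℕ) : Measurable (jumpTime Y Z n) :=
  Finset.measurable_sum _ fun k _ => h.measurable_sojourn k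

/-- Independence of the trajectory of the chain, the past jump time along a fixed trajectory,
and the next sojourn variable. -/
theorem measure_trajectory {G : Set (ℕ → Fin (p + 1))} (hG : MeasurableSet G)
    (y : ℕ → Fin (p + 1)) (n : ℕ) (k : Fin p) {A : Set ENNReal} (hA : MeasurableSet A)
    {B : Set ℝ} (hB : MeasurableSet B) :
    μ {ω | (fun n => Y n ω) ∈ G ∧ (trajectoryJumpTime y n fun a => Z a.1 a.2 ω) ∈ A ∧
      Z k n ω ∈ B} =
    μ {ω | (fun n => Y n ω) ∈ G} *
      (μ {ω | (trajectoryJumpTime y n fun a => Z a.1 a.2 ω) ∈ A} * μ {ω | Z k n ω ∈ B}) := by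
  have hT := measurable_trajectoryJumpTime (p := p) y n
  have hsplit := h.indep_chain.measure_inter_preimage_eq_mul G
    {z : Fin p × ℕ → ℝ | trajectoryJumpTime y n z ∈ A ∧ z (k, n) ∈ B} hG
    ((hT hA).inter (measurable_pi_apply (k, n) hB))
  refine hsplit.trans ?_
  congr 1
  -- Along a fixed trajectory the `n`-th jump time involves only variables with time index below
  -- `n`, hence not `Z k n`.
  set S : Finset (Fin p × ℕ) := Finset.univ ×ˢ Finset.range n with hS
  have hdisj : Disjoint S {(k, n)} := by simp [hS]
  have hind := h.indep.indepFun_finset S {(k, n)} hdisj fun a => h.measurable_variable a.1 a.2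
  have hφ : Measurable fun w : S → ℝ => ∑ x : Finset.range n,
      Fin.lastCases (motive := fun _ => ENNReal) ⊤
        (fun i => ENNReal.ofReal (w ⟨(i, x.1), by simp [hS]⟩))
        (y x.1) :=
    Finset.measurable_sum _ fun x _ => measurable_lastCases_top (fun i => measurable_pi_apply _) _
  have hψ : Measurable fun w : ({(k, n)} : Finset (Fin p × ℕ)) → ℝ => w ⟨(k, n), by simp⟩ :=
    measurable_pi_apply _
  have hind2 := (hind.comp hφ hψ).measure_inter_preimage_eq_mul A B hA hB
  have e : (fun w : S → ℝ => ∑ x : Finset.range n,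
      Fin.lastCases (motive := fun _ => ENNReal) ⊤
        (fun i => ENNReal.ofReal (w ⟨(i, x.1), by simp [hS]⟩))
        (y x.1)) ∘ (fun ω (a : S) => Z a.1.1 a.1.2 ω) =
      fun ω => trajectoryJumpTime y n fun a => Z a.1 a.2 ω := by
    ext ω
    exact Finset.sum_coe_sort (Finset.range n) fun x =>
      Fin.lastCases (motive := fun _ => ENNReal) ⊤ (fun i => ENNReal.ofReal (Z i x ω)) (y x)
  rw [e] at hind2
  exact hind2

/-- Once the trajectory is fixed, the jump time is a function of the `Z` variables alone.
Independence then factors both sides, and the two trajectory probabilities differ by one transition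
of the chain. -/
theorem measure_step_trajectory (y : ℕ → Fin (p + 1)) (n : ℕ) {k : Fin p}
    (hy : y n = k.castSucc) {A : Set ENNReal} (hA : MeasurableSet A)
    {B : Set ℝ} (hB : MeasurableSet B) :
    μ {ω | (∀ m ≤ n + 1, Y m ω = y m) ∧ jumpTime Y Z n ω ∈ A ∧ Z k n ω ∈ B} =
      ENNReal.ofReal (Q k.castSucc (y (n + 1))) *
        (μ {ω | (∀ m ≤ n, Y m ω = y m) ∧ jumpTime Y Z n ω ∈ A} * μ {ω | Z k n ω ∈ B}) := by
  have := h.isProbabilityMeasure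
  have hG : ∀ N : ℕ, MeasurableSet {x : ℕ → Fin (p + 1) | ∀ m ≤ N, x m = y m} := fun N => by
    simp only [Set.ofPred_forall]
    exact MeasurableSet.iInter fun m => MeasurableSet.iInter fun _ =>
      measurableSet_eq_fun (measurable_pi_apply m) measurable_const
  have h1 := h.measure_trajectory (hG (n + 1)) y n k hA hB
  -- Taking `B` to be everything removes the sojourn from the event.
  have h2 := h.measure_trajectory (hG n) y n k hA MeasurableSet.univ
  simp only [Set.mem_ofPred_eq, Set.mem_univ, and_true, Set.ofPred_true, measure_univ,
    mul_one] at h1 h2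
  have e1 : {ω | (∀ m ≤ n + 1, Y m ω = y m) ∧ jumpTime Y Z n ω ∈ A ∧ Z k n ω ∈ B} =
      {ω | (∀ m ≤ n + 1, Y m ω = y m) ∧
        (trajectoryJumpTime y n fun a => Z a.1 a.2 ω) ∈ A ∧ Z k n ω ∈ B} := by
    ext ω
    refine and_congr_right fun hω => ?_
    rw [jumpTime_eq_trajectoryJumpTime fun m hm => hω m (by omega)]
  have e2 : {ω | (∀ m ≤ n, Y m ω = y m) ∧ jumpTime Y Z n ω ∈ A} =
      {ω | (∀ m ≤ n, Y m ω = y m) ∧ (trajectoryJumpTime y n fun a => Z a.1 a.2 ω) ∈ A} := by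
    ext ω
    refine and_congr_right fun hω => ?_
    rw [jumpTime_eq_trajectoryJumpTime fun m hm => hω m (by omega)]
  rw [e1, e2, h1, h2, h.markov.2 n y, hy]
  ring

theorem measure_eq_sum_chain (n : ℕ) (E : Set Ω) :
    μ E = ∑ l, μ (E ∩ {ω | Y n ω = l}) := by
  have := sum_measure_preimage_singleton (μ := μ.restrict E) (Finset.univ : Finset (Fin (p + 1)))
    (f := Y n) fun l _ => h.measurable_chain n (MeasurableSet.singleton l)
  rw [Finset.coe_univ, Set.preimage_univ, Measure.restrict_apply_univ] at this
  rw [← this]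
  refine Finset.sum_congr rfl fun l _ => ?_
  rw [Measure.restrict_apply (h.measurable_chain n (MeasurableSet.singleton l)), Set.inter_comm]
  rfl

theorem measure_eq_sum_trajectory (n : ℕ) (E : Set Ω) :
    μ E = ∑ f : Fin (n + 1) → Fin (p + 1), μ (E ∩ {ω | ∀ m : Fin (n + 1), Y m ω = f m}) := by
  have hm : Measurable fun ω (m : Fin (n + 1)) => Y m ω :=
    measurable_pi_lambda _ fun m => h.measurable_chain m
  have := sum_measure_preimage_singleton (μ := μ.restrict E)
    (Finset.univ : Finset (Fin (n + 1) → Fin (p + 1)))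
    (f := fun ω (m : Fin (n + 1)) => Y m ω) fun l _ => hm (MeasurableSet.singleton l)
  rw [Finset.coe_univ, Set.preimage_univ, Measure.restrict_apply_univ] at this
  rw [← this]
  refine Finset.sum_congr rfl fun f _ => ?_
  rw [Measure.restrict_apply (hm (MeasurableSet.singleton f)), Set.inter_comm]
  congr 2
  ext ω
  simp [funext_iff]

/-- The Markov property at the `n`-th jump. -/
theorem measure_step (i : Fin (p + 1)) (n : ℕ) (k : Fin p) (l : Fin (p + 1)) {A : Set ENNReal}
    (hA : MeasurableSet A) {B : Set ℝ} (hB : MeasurableSet B) :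
    μ ({ω | Y 0 ω = i ∧ Y n ω = k.castSucc ∧ jumpTime Y Z n ω ∈ A ∧ Z k n ω ∈ B} ∩
      {ω | Y (n + 1) ω = l}) =
    ENNReal.ofReal (Q k.castSucc l) *
      (μ {ω | Y 0 ω = i ∧ Y n ω = k.castSucc ∧ jumpTime Y Z n ω ∈ A} *
        μ {ω | Z k n ω ∈ B}) := by
  rw [h.measure_eq_sum_trajectory n ({ω | _} ∩ _),
    h.measure_eq_sum_trajectory n {ω | Y 0 ω = i ∧ Y n ω = k.castSucc ∧ jumpTime Y Z n ω ∈ A},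
    Finset.sum_mul, Finset.mul_sum]
  refine Finset.sum_congr rfl fun f _ => ?_
  by_cases hf : f 0 = i ∧ f (Fin.last n) = k.castSucc
  -- The finite trajectory is continued by the prescribed next state `l`. Trajectories with the
  -- wrong endpoints contribute nothing to either side.
  · set y : ℕ → Fin (p + 1) := fun m => if hm : m < n + 1 then f ⟨m, hm⟩ else l with hy
    have hyl : y (n + 1) = l := by simp [hy]
    have hyf : ∀ m : Fin (n + 1), y m = f m := fun m => dif_pos m.2
    have hyn : y n = k.castSucc := (hyf (Fin.last n)).trans hf.2
    have key := h.measure_step_trajectory y n hyn hA hB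
    have hpath : ∀ ω, (∀ m : Fin (n + 1), Y m ω = f m) ↔ ∀ m ≤ n, Y m ω = y m := fun ω => by
      constructor
      · intro hω m hm
        rw [hω ⟨m, by omega⟩, ← hyf]
      · intro hω m
        rw [hω m (by omega), hyf]
    have h0 : ∀ ω, (∀ m ≤ n, Y m ω = y m) → Y 0 ω = i ∧ Y n ω = k.castSucc := fun ω hω =>
      ⟨(hω 0 (by omega)).trans ((hyf 0).trans hf.1), (hω n le_rfl).trans hyn⟩
    rw [hyl] at key
    convert key using 3
    · ext ω
      simp only [Set.mem_inter_iff, Set.mem_ofPred_eq, hpath]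
      constructor
      · rintro ⟨⟨⟨-, -, h1, h2⟩, h3⟩, h4⟩
        refine ⟨fun m hm => ?_, h1, h2⟩
        rcases hm.lt_or_eq with hlt | rfl
        · exact h4 m (by omega)
        · rw [h3, hyl]
      · rintro ⟨h4, h1, h2⟩
        have h5 : ∀ m ≤ n, Y m ω = y m := fun m hm => h4 m (by omega)
        exact ⟨⟨⟨(h0 ω h5).1, (h0 ω h5).2, h1, h2⟩, (h4 _ le_rfl).trans hyl⟩, h5⟩
    · congr 1
      ext ω
      simp only [Set.mem_inter_iff, Set.mem_ofPred_eq, hpath]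
      constructor
      · rintro ⟨⟨-, -, h1⟩, h4⟩
        exact ⟨h4, h1⟩
      · rintro ⟨h4, h1⟩
        exact ⟨⟨(h0 ω h4).1, (h0 ω h4).2, h1⟩, h4⟩
  · have hem : ∀ ω, ¬ ((∀ m : Fin (n + 1), Y m ω = f m) ∧ Y 0 ω = i ∧ Y n ω = k.castSucc) :=
      fun ω ⟨hω, h1, h2⟩ => hf ⟨(hω 0).symm.trans h1, (hω (Fin.last n)).symm.trans h2⟩
    have e1 : {ω | Y 0 ω = i ∧ Y n ω = k.castSucc ∧ jumpTime Y Z n ω ∈ A ∧ Z k n ω ∈ B} ∩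
        {ω | Y (n + 1) ω = l} ∩ {ω | ∀ m : Fin (n + 1), Y m ω = f m} = ∅ := by
      ext ω
      simp only [Set.mem_inter_iff, Set.mem_ofPred_eq, Set.mem_empty_iff_false, iff_false]
      exact fun ⟨⟨⟨h1, h2, _⟩, _⟩, h4⟩ => hem ω ⟨h4, h1, h2⟩
    have e2 : {ω | Y 0 ω = i ∧ Y n ω = k.castSucc ∧ jumpTime Y Z n ω ∈ A} ∩
        {ω | ∀ m : Fin (n + 1), Y m ω = f m} = ∅ := by
      ext ω
      simp only [Set.mem_inter_iff, Set.mem_ofPred_eq, Set.mem_empty_iff_false, iff_false]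
      exact fun ⟨⟨h1, h2, _⟩, h4⟩ => hem ω ⟨h4, h1, h2⟩
    rw [e1, e2]
    simp

/-- Sum `measure_step` over the next state; the row of `Q` sums to 1. -/
theorem measure_sojourn (hQ : Q ∈ Matrix.rowStochastic ℝ (Fin (p + 1))) (i : Fin (p + 1)) (n : ℕ)
    (k : Fin p) {A : Set ENNReal} (hA : MeasurableSet A) {B : Set ℝ} (hB : MeasurableSet B) :
    μ {ω | Y 0 ω = i ∧ Y n ω = k.castSucc ∧ jumpTime Y Z n ω ∈ A ∧ Z k n ω ∈ B} =
      μ {ω | Y 0 ω = i ∧ Y n ω = k.castSucc ∧ jumpTime Y Z n ω ∈ A} * μ {ω | Z k n ω ∈ B} := by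
  rw [h.measure_eq_sum_chain (n + 1)]
  simp only [h.measure_step i n k _ hA hB]
  rw [← Finset.sum_mul, ← ENNReal.ofReal_sum_of_nonneg fun l _ => Matrix.nonneg_of_mem_rowStochastic hQ,
    Matrix.sum_row_of_mem_rowStochastic hQ, ENNReal.ofReal_one, one_mul]

/-- All sojourn variables of a state have the same law. -/
theorem map_variable_eq (k : Fin p) (n n' : ℕ) : μ.map (Z k n) = μ.map (Z k n') := by
  have := h.isProbabilityMeasure
  refine Measure.ext_of_Iic _ _ fun x => ?_
  rw [Measure.map_apply (h.measurable_variable k n) measurableSet_Iic,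
    Measure.map_apply (h.measurable_variable k n') measurableSet_Iic,
    ← ENNReal.toReal_eq_toReal_iff' (by finiteness) (by finiteness)]
  exact ((h.law k n).2 x).trans ((h.law k n').2 x).symm

theorem map_variable_real_Iic (k : Fin p) (n : ℕ) (x : ℝ) :
    (μ.map (Z k n)).real (Set.Iic x) = ∫ u in Set.Iic x, mittagLefflerPDF α (lam k) u := by
  rw [← (h.law k n).2 x, measureReal_def,
    Measure.map_apply (h.measurable_variable k n) measurableSet_Iic]
  rfl

end IsMLSemiMarkovData

/-! ### Laws of the jump times and the transition probabilities. -/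

/-- The law of the `n`-th jump time on the event that the chain starts in `i` and is in the
transient state `k` after `n` jumps. -/
noncomputable def stateJumpLaw {Ω : Type*} [MeasurableSpace Ω] {p : ℕ} (μ : Measure Ω)
    (Y : ℕ → Ω → Fin (p + 1)) (Z : Fin p → ℕ → Ω → ℝ) (i : Fin (p + 1)) (n : ℕ) (k : Fin p) :
    Measure ℝ :=
  (μ.restrict {ω | Y 0 ω = i ∧ Y n ω = k.castSucc ∧ jumpTime Y Z n ω ≠ ⊤}).map
    fun ω => (jumpTime Y Z n ω).toReal

namespace IsMLSemiMarkovData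

variable {Ω : Type*} [MeasurableSpace Ω] {p : ℕ} {μ : Measure Ω} {α : ℝ} {lam : Fin p → ℝ}
  {Q : Matrix (Fin (p + 1)) (Fin (p + 1)) ℝ} {Y : ℕ → Ω → Fin (p + 1)} {Z : Fin p → ℕ → Ω → ℝ}
  (h : IsMLSemiMarkovData μ α lam Q Y Z)
include h

theorem measurable_toReal_jumpTime (n : ℕ) : Measurable fun ω => (jumpTime Y Z n ω).toReal :=
  (h.measurable_jumpTime n).ennreal_toReal

theorem stateJumpLaw_apply (i : Fin (p + 1)) (n : ℕ) (k : Fin p) {A : Set ℝ}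
    (hA : MeasurableSet A) :
    stateJumpLaw μ Y Z i n k A = μ {ω | Y 0 ω = i ∧ Y n ω = k.castSucc ∧
      jumpTime Y Z n ω ∈ ENNReal.toReal ⁻¹' A ∩ {⊤}ᶜ} := by
  rw [stateJumpLaw, Measure.map_apply (h.measurable_toReal_jumpTime n) hA,
    Measure.restrict_apply (h.measurable_toReal_jumpTime n hA)]
  congr 1
  ext ω
  simp only [Set.mem_inter_iff, Set.mem_preimage, Set.mem_ofPred_eq, Set.mem_compl_iff,
    Set.mem_singleton_iff]
  tauto

theorem isFiniteMeasure_stateJumpLaw (i : Fin (p + 1)) (n : ℕ) (k : Fin p) :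
    IsFiniteMeasure (stateJumpLaw μ Y Z i n k) := by
  have := h.isProbabilityMeasure
  unfold stateJumpLaw
  infer_instance

theorem isProbabilityMeasure_map (k : Fin p) (n : ℕ) : IsProbabilityMeasure (μ.map (Z k n)) := by
  have := h.isProbabilityMeasure
  exact Measure.isProbabilityMeasure_map (h.measurable_variable k n).aemeasurable

theorem ae_pos : ∀ᵐ ω ∂μ, ∀ k n, 0 < Z k n ω := by
  rw [ae_all_iff]
  refine fun k => ae_all_iff.2 fun n => ?_
  have := h.isProbabilityMeasure_map k n
  have h0 := measure_Iic_zero_of_mittagLeffler (h.map_variable_real_Iic k n)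
  rw [Measure.map_apply (h.measurable_variable k n) measurableSet_Iic] at h0
  have : ∀ᵐ ω ∂μ, ω ∉ Z k n ⁻¹' Set.Iic 0 := measure_eq_zero_iff_ae_notMem.1 h0
  filter_upwards [this] with ω hω using not_le.1 hω

theorem measure_variable_mem (k : Fin p) (n : ℕ) {B : Set ℝ} (hB : MeasurableSet B) :
    μ {ω | Z k n ω ∈ B} = μ.map (Z k 0) B := by
  rw [h.map_variable_eq k 0 n, Measure.map_apply (h.measurable_variable k n) hB]
  rfl

theorem map_jumpTime_variable (hQ : Q ∈ Matrix.rowStochastic ℝ (Fin (p + 1))) (i : Fin (p + 1))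
    (n : ℕ) (k : Fin p) :
    (μ.restrict {ω | Y 0 ω = i ∧ Y n ω = k.castSucc ∧ jumpTime Y Z n ω ≠ ⊤}).map
      (fun ω => ((jumpTime Y Z n ω).toReal, Z k n ω)) =
    (stateJumpLaw μ Y Z i n k).prod (μ.map (Z k 0)) := by
  have := h.isFiniteMeasure_stateJumpLaw i n k
  have := h.isProbabilityMeasure_map k 0
  have hm := (h.measurable_toReal_jumpTime n).prodMk (h.measurable_variable k n)
  refine (Measure.prod_eq fun A B hA hB => ?_).symm
  rw [Measure.map_apply hm (hA.prod hB), Measure.restrict_apply (hm (hA.prod hB)),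
    h.stateJumpLaw_apply i n k hA, ← h.measure_variable_mem k n hB,
    ← h.measure_sojourn hQ i n k (ENNReal.measurable_toReal hA |>.inter (measurableSet_singleton ⊤).compl)
      hB]
  congr 1
  ext ω
  simp only [Set.mem_inter_iff, Set.mem_preimage, Set.mem_ofPred_eq, Set.mem_compl_iff,
    Set.mem_singleton_iff, Set.mem_prod]
  tauto

theorem map_jumpTime_variable_step (i : Fin (p + 1)) (n : ℕ) (k : Fin p) (l : Fin (p + 1)) :
    (μ.restrict ({ω | Y 0 ω = i ∧ Y n ω = k.castSucc ∧ jumpTime Y Z n ω ≠ ⊤} ∩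
      {ω | Y (n + 1) ω = l})).map (fun ω => ((jumpTime Y Z n ω).toReal, Z k n ω)) =
    (ENNReal.ofReal (Q k.castSucc l) • stateJumpLaw μ Y Z i n k).prod (μ.map (Z k 0)) := by
  have := h.isFiniteMeasure_stateJumpLaw i n k
  have := h.isProbabilityMeasure_map k 0
  have : IsFiniteMeasure (ENNReal.ofReal (Q k.castSucc l) • stateJumpLaw μ Y Z i n k) :=
    Measure.smul_finite _ ENNReal.ofReal_ne_top
  have hm := (h.measurable_toReal_jumpTime n).prodMk (h.measurable_variable k n)
  refine (Measure.prod_eq fun A B hA hB => ?_).symm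
  rw [Measure.map_apply hm (hA.prod hB), Measure.restrict_apply (hm (hA.prod hB)),
    Measure.smul_apply, smul_eq_mul,
    h.stateJumpLaw_apply i n k hA, ← h.measure_variable_mem k n hB, mul_assoc,
    ← h.measure_step i n k l (ENNReal.measurable_toReal hA |>.inter (measurableSet_singleton ⊤).compl) hB]
  congr 1
  ext ω
  simp only [Set.mem_inter_iff, Set.mem_preimage, Set.mem_ofPred_eq, Set.mem_compl_iff,
    Set.mem_singleton_iff, Set.mem_prod]
  tauto

/-- Condition on the state before the last jump. The absorbing state contributes nothing, since its
sojourn is infinite; a transient state contributes its own jump law convolved with a fresh sojourn.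
-/
theorem stateJumpLaw_succ (i : Fin (p + 1)) (n : ℕ) (l : Fin p) :
    stateJumpLaw μ Y Z i (n + 1) l =
      ∑ k, (ENNReal.ofReal (Q k.castSucc l.castSucc) • stateJumpLaw μ Y Z i n k) ∗
        μ.map (Z k 0) := by
  ext A hA
  rw [h.stateJumpLaw_apply i (n + 1) l hA, h.measure_eq_sum_chain n, Fin.sum_univ_castSucc,
    Measure.finsetSum_apply]
  have hlast : μ ({ω | Y 0 ω = i ∧ Y (n + 1) ω = l.castSucc ∧
      jumpTime Y Z (n + 1) ω ∈ ENNReal.toReal ⁻¹' A ∩ {⊤}ᶜ} ∩ {ω | Y n ω = Fin.last p}) = 0 := by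
    rw [← measure_empty (μ := μ)]
    congr 1
    ext ω
    simp only [Set.mem_inter_iff, Set.mem_ofPred_eq, Set.mem_empty_iff_false, iff_false]
    rintro ⟨⟨-, -, -, h1⟩, h2⟩
    refine h1 ?_
    rw [Set.mem_singleton_iff, jumpTime_succ, sojourn_of_eq_last h2, add_top]
  rw [hlast, add_zero]
  refine Finset.sum_congr rfl fun k _ => ?_
  have hm := (h.measurable_toReal_jumpTime n).prodMk (h.measurable_variable k n)
  have hadd : Measurable fun x : ℝ × ℝ => x.1 + x.2 := measurable_fst.add measurable_snd
  rw [Measure.conv, ← h.map_jumpTime_variable_step i n k l.castSucc,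
    Measure.map_apply hadd hA, Measure.map_apply hm (hadd hA), Measure.restrict_apply (hm (hadd hA))]
  refine measure_congr (Filter.eventuallyEq_set.2 ?_)
  filter_upwards [h.ae_pos] with ω hω
  simp only [Set.mem_inter_iff, Set.mem_preimage, Set.mem_compl_iff, Set.mem_ofPred_eq,
    Set.mem_singleton_iff]
  have key : Y n ω = k.castSucc → (jumpTime Y Z (n + 1) ω ≠ ⊤ ↔ jumpTime Y Z n ω ≠ ⊤) ∧
      (jumpTime Y Z n ω ≠ ⊤ →
        (jumpTime Y Z (n + 1) ω).toReal = (jumpTime Y Z n ω).toReal + Z k n ω) := by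
    intro hk
    rw [jumpTime_succ, sojourn_of_eq_castSucc hk]
    refine ⟨by simp, fun hne => ?_⟩
    rw [ENNReal.toReal_add hne ENNReal.ofReal_ne_top, ENNReal.toReal_ofReal (hω k n).le]
  constructor
  · rintro ⟨⟨h1, h2, h3, h4⟩, h5⟩
    have h6 := (key h5).1.1 h4
    exact ⟨(key h5).2 h6 ▸ h3, ⟨h1, h5, h6⟩, h2⟩
  · rintro ⟨h3, ⟨h1, h5, h6⟩, h2⟩
    exact ⟨⟨h1, h2, (key h5).2 h6 ▸ h3, (key h5).1.2 h6⟩, h5⟩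

theorem isSemiMarkovConvolution (hQ : Q ∈ Matrix.rowStochastic ℝ (Fin (p + 1)))
    (i : Fin (p + 1)) :
    IsSemiMarkovConvolution (Matrix.of fun k l : Fin p => Q k.castSucc l.castSucc)
      (fun k => μ.map (Z k 0)) (stateJumpLaw μ Y Z i) where
  nonneg k l := Matrix.nonneg_of_mem_rowStochastic hQ
  sum_le k := by
    have hs := Matrix.sum_row_of_mem_rowStochastic hQ k.castSucc
    rw [Fin.sum_univ_castSucc] at hs
    have : 0 ≤ Q k.castSucc (Fin.last p) := Matrix.nonneg_of_mem_rowStochastic hQ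
    simp only [Matrix.of_apply]
    linarith
  prob k := h.isProbabilityMeasure_map k 0
  pos k := by
    have := h.isProbabilityMeasure_map k 0
    exact measure_Iic_zero_of_mittagLeffler (h.map_variable_real_Iic k 0)
  finite n k := h.isFiniteMeasure_stateJumpLaw i n k
  support n k := by
    rw [h.stateJumpLaw_apply i n k measurableSet_Iio, ← measure_empty (μ := μ)]
    congr 1
    ext ω
    simp only [Set.mem_inter_iff, Set.mem_preimage, Set.mem_Iio, Set.mem_ofPred_eq,
      Set.mem_empty_iff_false, iff_false]
    exact fun hω => hω.2.2.1.not_ge ENNReal.toReal_nonneg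
  step n l := h.stateJumpLaw_succ i n l

theorem measure_sojourn_interval (hQ : Q ∈ Matrix.rowStochastic ℝ (Fin (p + 1)))
    (i : Fin (p + 1)) (n : ℕ) (k : Fin p) {t : ℝ} (ht : 0 ≤ t) :
    μ {ω | Y 0 ω = i ∧ Y n ω = k.castSucc ∧ jumpTime Y Z n ω ≤ ENNReal.ofReal t ∧
      ENNReal.ofReal t < jumpTime Y Z (n + 1) ω} =
    (stateJumpLaw μ Y Z i n k).prod (μ.map (Z k 0)) {x : ℝ × ℝ | x.1 ≤ t ∧ t < x.1 + x.2} := by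
  have hm := (h.measurable_toReal_jumpTime n).prodMk (h.measurable_variable k n)
  have hD : MeasurableSet {x : ℝ × ℝ | x.1 ≤ t ∧ t < x.1 + x.2} :=
    (measurableSet_le measurable_fst measurable_const).inter
      (measurableSet_lt measurable_const (measurable_fst.add measurable_snd))
  rw [← h.map_jumpTime_variable hQ i n k, Measure.map_apply hm hD, Measure.restrict_apply (hm hD)]
  refine measure_congr (Filter.eventuallyEq_set.2 ?_)
  filter_upwards [h.ae_pos] with ω hω
  simp only [Set.mem_inter_iff, Set.mem_preimage, Set.mem_ofPred_eq]
  have key : Y n ω = k.castSucc → jumpTime Y Z n ω ≠ ⊤ →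
      ((jumpTime Y Z n ω ≤ ENNReal.ofReal t ↔ (jumpTime Y Z n ω).toReal ≤ t) ∧
        (ENNReal.ofReal t < jumpTime Y Z (n + 1) ω ↔
          t < (jumpTime Y Z n ω).toReal + Z k n ω)) := by
    intro hk hne
    rw [jumpTime_succ, sojourn_of_eq_castSucc hk]
    obtain ⟨s, hs⟩ : ∃ s, s = (jumpTime Y Z n ω).toReal := ⟨_, rfl⟩
    have hs0 : 0 ≤ s := hs ▸ ENNReal.toReal_nonneg
    have hse : jumpTime Y Z n ω = ENNReal.ofReal s := by rw [hs, ENNReal.ofReal_toReal hne]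
    have hz := hω k n
    rw [← hs, hse, ENNReal.ofReal_le_ofReal_iff ht, ← ENNReal.ofReal_add hs0 hz.le,
      ENNReal.ofReal_lt_ofReal_iff (by linarith)]
    exact ⟨Iff.rfl, Iff.rfl⟩
  constructor
  · rintro ⟨h1, h2, h3, h4⟩
    have hne : jumpTime Y Z n ω ≠ ⊤ := ne_top_of_le_ne_top ENNReal.ofReal_ne_top h3
    exact ⟨⟨(key h2 hne).1.1 h3, (key h2 hne).2.1 h4⟩, h1, h2, hne⟩
  · rintro ⟨⟨h3, h4⟩, h1, h2, hne⟩
    exact ⟨h1, h2, (key h2 hne).1.2 h3, (key h2 hne).2.2 h4⟩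

theorem stateJumpLaw_zero (i k : Fin p) :
    stateJumpLaw μ Y Z i.castSucc 0 k =
      if k = i then μ {ω | Y 0 ω = i.castSucc} • Measure.dirac 0 else 0 := by
  ext A hA
  rw [h.stateJumpLaw_apply _ 0 k hA]
  simp only [jumpTime_zero]
  split_ifs with hki
  · subst hki
    rw [Measure.smul_apply, Measure.dirac_apply' _ hA]
    by_cases h0 : (0 : ℝ) ∈ A <;> simp [h0]
  · rw [Measure.coe_zero, Pi.zero_apply, ← measure_empty (μ := μ)]
    congr 1
    ext ω
    simp only [Set.mem_ofPred_eq, Set.mem_empty_iff_false, iff_false]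
    exact fun hω => hki (Fin.castSucc_injective p (hω.2.1.symm.trans hω.1))

/-- Sojourns are almost surely positive, so `n = 0` is the only index whose interval contains time
0. -/
theorem start_ae_eq (i : Fin (p + 1)) :
    {ω | semiMarkovProcess Y Z 0 ω = some i} =ᵐ[μ] {ω | Y 0 ω = i} := by
  refine Filter.eventuallyEq_set.2 ?_
  filter_upwards [h.ae_pos] with ω hω
  have h1 : ENNReal.ofReal 0 < jumpTime Y Z (0 + 1) ω := by
    rw [jumpTime_succ, jumpTime_zero, zero_add, ENNReal.ofReal_zero]
    rcases Fin.eq_castSucc_or_eq_last (Y 0 ω) with ⟨k, hk⟩ | hk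
    · rw [sojourn_of_eq_castSucc hk]
      exact ENNReal.ofReal_pos.2 (hω k 0)
    · rw [sojourn_of_eq_last hk]
      exact ENNReal.zero_lt_top
  have h0 : jumpTime Y Z 0 ω ≤ ENNReal.ofReal 0 := by simp [jumpTime_zero]
  refine semiMarkovProcess_eq_some_iff.trans ⟨?_, fun hi => ⟨0, hi, h0, h1⟩⟩
  rintro ⟨n, hn, h2, h3⟩
  have : n = 0 := jumpTime_interval_unique h2 h3 h0 h1
  exact this ▸ hn

/-- The transition probabilities are given by the matrix Mittag-Leffler function. -/
theorem cond_real_state_eq (hα : 0 < α)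
    (hQ : Q ∈ Matrix.rowStochastic ℝ (Fin (p + 1))) {T : Matrix (Fin p) (Fin p) ℝ}
    (hT : ∀ k l, T k l = lam k * Q k.castSucc l.castSucc - if k = l then lam k else 0)
    (i j : Fin p) (hstart : μ {ω | semiMarkovProcess Y Z 0 ω = some i.castSucc} ≠ 0)
    {t : ℝ} (ht : 0 ≤ t) :
    (ProbabilityTheory.cond μ {ω | semiMarkovProcess Y Z 0 ω = some i.castSucc}).real
      {ω | semiMarkovProcess Y Z t ω = some j.castSucc} =
    mlSeries α 1 (fun n => (T ^ n) i j) (t ^ α) := by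
  have := h.isProbabilityMeasure
  have := fun k => h.isProbabilityMeasure_map k 0
  have hY0 : MeasurableSet {ω | Y 0 ω = i.castSucc} :=
    h.measurable_chain 0 (MeasurableSet.singleton _)
  have hcond : ProbabilityTheory.cond μ {ω | semiMarkovProcess Y Z 0 ω = some i.castSucc} =
      ProbabilityTheory.cond μ {ω | Y 0 ω = i.castSucc} := by
    unfold ProbabilityTheory.cond
    rw [measure_congr (h.start_ae_eq i.castSucc), Measure.restrict_congr_set (h.start_ae_eq _)]
  rw [measure_congr (h.start_ae_eq i.castSucc)] at hstart
  set E : ℕ → Set Ω := fun n => {ω | Y 0 ω = i.castSucc ∧ Y n ω = j.castSucc ∧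
    jumpTime Y Z n ω ≤ ENNReal.ofReal t ∧ ENNReal.ofReal t < jumpTime Y Z (n + 1) ω} with hE
  have hEm : ∀ n, MeasurableSet (E n) := fun n =>
    hY0.inter ((h.measurable_chain n (MeasurableSet.singleton _)).inter
      ((measurableSet_le (h.measurable_jumpTime n) measurable_const).inter
        (measurableSet_lt measurable_const (h.measurable_jumpTime (n + 1)))))
  have hEd : Pairwise (Function.onFun Disjoint E) := fun n n' hne => by
    refine Set.disjoint_left.2 fun ω h1 h2 => hne ?_
    exact jumpTime_interval_unique h1.2.2.1 h1.2.2.2 h2.2.2.1 h2.2.2.2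
  have hU : {ω | Y 0 ω = i.castSucc} ∩ {ω | semiMarkovProcess Y Z t ω = some j.castSucc} =
      ⋃ n, E n := by
    ext ω
    simp only [hE, Set.mem_inter_iff, Set.mem_ofPred_eq, Set.mem_iUnion,
      semiMarkovProcess_eq_some_iff, exists_and_left]
  have he : ∀ k, Continuous fun s : ℝ => mlSeries α 1 (fun n => (T ^ n) k j) (s ^ α) := fun k =>
    (continuous_mlSeries hα one_pos (expBounded_matrix_pow T k j)).comp
      (Real.continuous_rpow_const hα.le)
  have hsum := (h.isSemiMarkovConvolution hQ i.castSucc).hasSum_of_renewal he j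
    (fun k s hs => mlSeries_matrix_renewal hα (q := Matrix.of fun k l => Q k.castSucc l.castSucc)
      hT (ν := fun k => μ.map (Z k 0)) (fun k => h.map_variable_real_Iic k 0) hs k j) ht
  -- The initial law is a point mass at 0 in state `i`, of weight `μ (Y 0 = i)`; the conditioning
  -- divides this weight out.
  have hinit : ∑ k, ∫ s in Set.Icc 0 t, mlSeries α 1 (fun n => (T ^ n) k j) ((t - s) ^ α)
      ∂(stateJumpLaw μ Y Z i.castSucc 0 k) =
      μ.real {ω | Y 0 ω = i.castSucc} * mlSeries α 1 (fun n => (T ^ n) i j) (t ^ α) := by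
    rw [Finset.sum_eq_single i]
    · rw [h.stateJumpLaw_zero, if_pos rfl, Measure.restrict_smul, integral_smul_measure,
        restrict_dirac' measurableSet_Icc, if_pos ⟨le_rfl, ht⟩, integral_dirac, sub_zero]
      rfl
    · intro k _ hk
      rw [h.stateJumpLaw_zero, if_neg hk]
      simp
    · simp
  rw [hinit] at hsum
  rw [hcond, measureReal_def, cond_apply hY0, hU, measure_iUnion hEd hEm, ENNReal.toReal_mul,
    ENNReal.tsum_toReal_eq fun n => measure_ne_top μ _]
  have hEsum : ∑' n, (μ (E n)).toReal =
      μ.real {ω | Y 0 ω = i.castSucc} * mlSeries α 1 (fun n => (T ^ n) i j) (t ^ α) := by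
    rw [← hsum.tsum_eq]
    exact tsum_congr fun n => by rw [hE, h.measure_sojourn_interval hQ _ n j ht]; rfl
  rw [hEsum, ENNReal.toReal_inv, measureReal_def, inv_mul_cancel_left₀]
  exact ENNReal.toReal_ne_zero.2 ⟨hstart, measure_ne_top _ _⟩

end IsMLSemiMarkovData

/-! ### The Kolmogorov equations. -/

theorem mainTheorem7 {Ω : Type*} [MeasurableSpace Ω] {p : ℕ} (α : ℝ) (hα0 : 0 < α) (hα1 : α ≤ 1)
    (lam : Fin p → ℝ) (hlam : ∀ i, 0 < lam i)
    (Q : Matrix (Fin (p + 1)) (Fin (p + 1)) ℝ)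
    (hQ : Q ∈ Matrix.rowStochastic ℝ (Fin (p + 1)))
    (hQabs : Q (Fin.last p) (Fin.last p) = 1)
    (hQdiag : ∀ i : Fin p, Q i.castSucc i.castSucc = 0)
    (μ : Fin p → Measure Ω)
    (Y : ℕ → Ω → Fin (p + 1)) (Z : Fin p → ℕ → Ω → ℝ)
    (hdata : ∀ i, IsMLSemiMarkovData (μ i) α lam Q Y Z)
    (hstart : ∀ i : Fin p, μ i {ω | semiMarkovProcess Y Z 0 ω = some i.castSucc} ≠ 0)
    (T : Matrix (Fin p) (Fin p) ℝ) (hT : T = subIntensity lam Q)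
    (P : ℝ → Matrix (Fin p) (Fin p) ℝ)
    (hP : P = transitionMatrix μ (semiMarkovProcess Y Z)) :
    (∀ t : ℝ, 0 ≤ t → P t = mittagLeffler α 1 (t ^ α • T)) ∧
      ∀ t : ℝ, 0 < t →
        (∀ i j, CaputoDifferentiableAt α (fun s => P s i j) t) ∧
          matrixCaputoDeriv α P t = T * P t ∧
          matrixCaputoDeriv α P t = P t * T := by
  -- A vanishing diagonal of `Q` on the transient states lets one formula cover both cases of `T`.
  have hTe : ∀ k l, T k l = lam k * Q k.castSucc l.castSucc - if k = l then lam k else 0 := by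
    intro k l
    rw [hT, subIntensity, Matrix.of_apply]
    split_ifs with hkl
    · rw [← hkl, hQdiag]
      ring
    · ring
  have hPe : ∀ i j s, 0 ≤ s → P s i j = mlSeries α 1 (fun n => (T ^ n) i j) (s ^ α) :=
    fun i j s hs => by
      rw [hP]
      exact (hdata i).cond_real_state_eq hα0 hQ hTe i j (hstart i) hs
  have hexp := fun i j => expBounded_matrix_pow T i j
  have hD : ∀ i j t, 0 < t → matrixCaputoDeriv α P t i j =
      mlSeries α 1 (fun n => (T ^ (n + 1)) i j) (t ^ α) := fun i j t ht =>
    caputoDeriv_eq_of_eq_mlSeries hα0 hα1 (hexp i j) (hPe i j) ht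
  refine ⟨fun t ht => ?_, fun t ht => ⟨fun i j => ?_, ?_, ?_⟩⟩
  · ext i j
    rw [hPe i j t ht, mittagLeffler_smul_matrix_apply hα0 one_pos]
  · exact caputoDifferentiableAt_of_eq_mlSeries hα0 hα1 (hexp i j) (hPe i j) ht
  · ext i j
    rw [hD i j t ht, Matrix.mul_apply]
    -- `pow_succ'` puts the new factor `T` on the left; `pow_succ` below puts it on the right.
    simp only [pow_succ', Matrix.mul_apply, hPe _ _ t ht.le]
    exact mlSeries_sum_mul hα0 Finset.univ (fun l => hexp l j) _ one_pos _
  · ext i j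
    rw [hD i j t ht, Matrix.mul_apply]
    simp only [pow_succ, Matrix.mul_apply, hPe _ _ t ht.le, mul_comm _ (T _ j)]
    exact mlSeries_sum_mul hα0 Finset.univ (fun l => hexp i l) _ one_pos _
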